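/- **Theorem 2.** *Setting.* Fix integers $N,r$. For every horizon $T$, units $1\le i\le N$ are observed at times $1\le t\le T$, and an intervention takes place at time $T_0=T_0(T)$, where $T_0/T\to\rho\in(0,1)$ as $T\to\infty$. All quantities below except $N,r,\bm\Lambda,\sigma_i,\bm\alpha_0,\rho,d$ may depend on $T$. The observed outcome $Y_{it}$ equals $Y_{it}(0)$ for $t\le T_0$ and $Y_{it}(1)$ for $t>T_0$, and $$Y_{it}(0)=\bm\lambda_i^{\mathsf T}\bm F_t+\varepsilon_{it},\qquad Y_{it}(1)=Y_{it}(0)+\beta_{it},\qquad E(\varepsilon_{it}\mid \bm F_t)=0,$$ with random factors $\bm F_t\in\mathbb R^r$, fixed loadings $\bm\Lambda=(\bm\lambda_1,\dots,\bm\lambda_N)^{\mathsf T}$ and non-random effects $\bm\beta_t=(\beta_{1t},\dots,\beta_{Nt})^{\mathsf T}$. Write $\bm\alpha_t=E(\bm F_t)$, $\bm\tau_t=\bm\beta_t+\bm\Lambda\bm\alpha_t$, $\mathcal C_t=\{i:\beta_{it}=0\}$. Assume: 1. $\bm\alpha_t=\bm\alpha_0$ for $t\le T_0$ (for $t>T_0$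 it may vary); $\operatorname{Var}(\bm F_t)=\mathbf I_r$; $\operatorname{Var}(\bm\varepsilon_t)=\bm\Sigma=\operatorname{diag}(\sigma_1^2,\dots,\sigma_N^2)$ with $\sigma_i>0$; $\bm\Lambda^{\mathsf T}\bm\Sigma^{-1}\bm\Lambda$ is diagonal with nonzero diagonal entries. 2. $|\mathcal C_t|\ge\lfloor N/2\rfloor+r$ for all $T_0<t\le T$. 3. The process $(\bm F_t-\bm\alpha_t,\bm\varepsilon_t)_{1\le t\le T}$ is strictly stationary with a law that does not depend on $T$, and for some $\delta>0$ it has finite moments of order $4+2\delta$ and strong mixing coefficients $\alpha(k)$ (suprema over all horizons) with $\sum_k\alpha(k)^{\delta/(2+\delta)}<\infty$. 4. After deletion of any row of $\bm\Lambda$ there remain two disjoint $r\times r$ submatrices of rank $r$. Moreover, for each $T_0<t\le T$, the loadings of any $|\mathcal C_t|+\lfloor N/2\rfloor+1-N$ or more units of $\mathcal C_t$ span $\mathbb R^r$ (by 2 this number is at least $r$, so this holds if every $r$ rows of $\bm\Lambda$ are linearly independent). *Estimators.* Let $0<d\le 1/2$ and let $t=t(T)$ with $T_0<t\le T$ be a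 post-intervention time at which $\bm\alpha_t$ is bounded in $T$ and the nonzero effects are bounded away from zero: there is $c>0$ such that $|\beta_{it}|\ge c$ for all large $T$ and all $i\notin\mathcal C_t$. (This is automatic if $\bm\alpha_t$ and $\bm\beta_t$ do not depend on $T$.) Let $\hat{\bm\tau}_t$ be an estimator with $\hat{\bm\tau}_t-\bm\tau_t=O_p(T^{-d})$. Let $\bar{\bm Y}=T_0^{-1}\sum_{s\le T_0}\bm Y_s$ and $\hat{\bm V}=T_0^{-1}\sum_{s\le T_0}(\bm Y_s-\bar{\bm Y})(\bm Y_s-\bar{\bm Y})^{\mathsf T}$. Let $\hat{\bm\Lambda}=(\hat{\bm\lambda}_1,\dots,\hat{\bm\lambda}_N)^{\mathsf T}$ be the maximum likelihood factor analysis estimator from the pre-intervention data, that is, whenever a minimizer exists, $(\hat{\bm\Lambda},\hat{\bm\Psi})$ minimizes $$\log\det(\bm L\bm L^{\mathsf T}+\bm\Psi)+\operatorname{tr}\{\hat{\bm V}(\bm L\bm L^{\mathsf T}+\bm\Psi)^{-1}\}$$ over $\bm L\in\mathbb R^{N\times r}$ and positive diagonal $\bm\Psi$, with $\hat{\bm\Lambda}^{\mathsf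 T}\hat{\bm\Psi}^{-1}\hat{\bm\Lambda}$ diagonal. Let $\hat{\bm\alpha}_t$ be any minimizer over $\bm a\in\mathbb R^r$ of the sum of the $\lfloor N/2\rfloor+1$ smallest among the squared residuals $(\hat\tau_{it}-\hat{\bm\lambda}_i^{\mathsf T}\bm a)^2$, $1\le i\le N$. Put $\hat{\bm\beta}_t=\hat{\bm\tau}_t-\hat{\bm\Lambda}\hat{\bm\alpha}_t$ and $$\hat{\mathcal C}_t=\bigl\{i:|\hat\tau_{it}-\hat{\bm\lambda}_i^{\mathsf T}\hat{\bm\alpha}_t|\le\{2\log(NT)\}^{1/2}\hat\sigma/T^{d}\bigr\},\qquad \hat\sigma^2=N^{-1}\sum_{i=\lceil N/2\rceil-r}^N\nu_i(\hat{\bm V}),$$ where $\nu_i(\hat{\bm V})$ is the $i$th largest eigenvalue of $\hat{\bm V}$. *Conclusion.* As $T\to\infty$, $\hat{\bm\beta}_t-\bm\beta_t=O_p(T^{-d})$ (entrywise) and $\Pr(\hat{\mathcal C}_t=\mathcal C_t)\to1$. -/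

import Mathlib

open MeasureTheory ProbabilityTheory Filter Topology

noncomputable section

namespace SCI

/-- A sequence of random variables is bounded in probability by the deterministic rate `b`:
`A T = O_p (b T)` as `T → ∞`. -/
def IsBigOp {Ω : Type*} [MeasurableSpace Ω] (μ : Measure Ω) (A : ℕ → Ω → ℝ) (b : ℕ → ℝ) : Prop :=
  ∀ η : ℝ, 0 < η → ∃ M : ℝ, ∀ᶠ T in atTop, μ.real {ω | M * b T < |A T ω|} ≤ η

/-- Strong mixing coefficient of two sub-σ-algebras:
`sup |P(A ∩ B) - P(A) P(B)|` over `A ∈ m₁`, `B ∈ m₂`. -/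
def alphaCoef {Ω : Type*} [MeasurableSpace Ω] (μ : Measure Ω) (m₁ m₂ : MeasurableSpace Ω) : ℝ :=
  sSup {x : ℝ | ∃ A B : Set Ω, MeasurableSet[m₁] A ∧ MeasurableSet[m₂] B ∧
    x = |μ.real (A ∩ B) - μ.real A * μ.real B|}

/-- σ-algebra generated by `Z t` for `a ≤ t ≤ b`. -/
abbrev sigmaBlock {Ω E : Type*} [MeasurableSpace E] (Z : ℕ → Ω → E) (a b : ℕ) : MeasurableSpace Ω :=
  ⨆ t ∈ Set.Icc a b, MeasurableSpace.comap (Z t) inferInstance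

/-- The `k`-th strong mixing coefficient of the array `(Z T t)`, `1 ≤ t ≤ T`: the supremum over
horizons `T` and times `s` of the coefficient between `Z T 1, …, Z T s` and
`Z T (s + k), …, Z T T`. -/
def mixingCoef {Ω E : Type*} [MeasurableSpace Ω] [MeasurableSpace E] (μ : Measure Ω)
    (Z : ℕ → ℕ → Ω → E) (k : ℕ) : ℝ :=
  ⨆ p : ℕ × ℕ, alphaCoef μ (sigmaBlock (Z p.1) 1 p.2) (sigmaBlock (Z p.1) (p.2 + k) p.1)

/-- The quantities of the panel with `N` units and `r` factors. The asymptotics run along the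
horizon `T`; the observed periods are `1 ≤ t ≤ T`, the intervention takes place at `T0 T`, and
everything else that may change with it carries the index `T` as well. -/
structure Panel (Ω : Type*) (N r : ℕ) where
  /-- number of pre-intervention periods -/
  T0 : ℕ → ℕ
  /-- potential outcomes without the intervention -/
  Y0 : ℕ → ℕ → Ω → Fin N → ℝ
  /-- potential outcomes under the intervention -/
  Y1 : ℕ → ℕ → Ω → Fin N → ℝ
  /-- observed outcomes -/
  Y : ℕ → ℕ → Ω → Fin N → ℝ
  /-- latent factors -/
  F : ℕ → ℕ → Ω → Fin r → ℝ
  /-- random errors -/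
  ε : ℕ → ℕ → Ω → Fin N → ℝ
  /-- effects of the intervention -/
  β : ℕ → ℕ → Fin N → ℝ
  /-- factor loadings -/
  Λ : Matrix (Fin N) (Fin r) ℝ
  /-- error standard deviations -/
  σ : Fin N → ℝ

namespace Panel

variable {Ω : Type*} {N r : ℕ}

/-- Indicator of the intervention. -/
def X (P : Panel Ω N r) (T t : ℕ) : ℕ := if P.T0 T < t then 1 else 0

/-- Consistency: the observed outcome is the potential outcome of the received intervention. -/
def Consistency (P : Panel Ω N r) : Prop :=
  ∀ T t, 1 ≤ t → t ≤ T → ∀ ω i,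
    (P.X T t = 0 → P.Y T t ω i = P.Y0 T t ω i) ∧ (P.X T t = 1 → P.Y T t ω i = P.Y1 T t ω i)

/-- Linear factor model, with errors that have conditional mean zero given the factors. -/
def LinearFactorModel [MeasurableSpace Ω] (P : Panel Ω N r) (μ : Measure Ω) : Prop :=
  ∀ T t, 1 ≤ t → t ≤ T →
    Measurable (P.F T t) ∧ Measurable (P.ε T t) ∧
    (∀ ω i, P.Y0 T t ω i = P.Λ.row i ⬝ᵥ P.F T t ω + P.ε T t ω i) ∧
    (∀ ω i, P.Y1 T t ω i = P.Y0 T t ω i + P.β T t i) ∧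
    (∀ i, Integrable (fun ω => P.ε T t ω i) μ ∧
      μ[fun ω => P.ε T t ω i | MeasurableSpace.comap (P.F T t) inferInstance] =ᵐ[μ] 0)

/-- `α_t = E(F_t)`. -/
def factorMean [MeasurableSpace Ω] (P : Panel Ω N r) (μ : Measure Ω) (T t : ℕ) : Fin r → ℝ :=
  fun k => ∫ ω, P.F T t ω k ∂μ

/-- Constant factor mean before the intervention, unit factor covariance, diagonal error
covariance, and the normalization of the loadings. -/
def FactorMoments [MeasurableSpace Ω] (P : Panel Ω N r) (μ : Measure Ω) : Prop :=
  (∃ α₀ : Fin r → ℝ, ∀ T t, 1 ≤ t → t ≤ T → t ≤ P.T0 T → P.factorMean μ T t = α₀) ∧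
  (∀ i, 0 < P.σ i) ∧
  (∀ T t, 1 ≤ t → t ≤ T →
    (∀ i, MemLp (fun ω => P.ε T t ω i) 2 μ) ∧
    (∀ k, MemLp (fun ω => P.F T t ω k) 2 μ) ∧
    (∀ i j, covariance (fun ω => P.ε T t ω i) (fun ω => P.ε T t ω j) μ =
      (Matrix.diagonal fun i => P.σ i ^ 2) i j) ∧
    (∀ k l, covariance (fun ω => P.F T t ω k) (fun ω => P.F T t ω l) μ =
      (1 : Matrix (Fin r) (Fin r) ℝ) k l)) ∧
  (P.Λ.transpose * (Matrix.diagonal fun i => P.σ i ^ 2)⁻¹ * P.Λ).IsDiag ∧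
  (∀ k, (P.Λ.transpose * (Matrix.diagonal fun i => P.σ i ^ 2)⁻¹ * P.Λ) k k ≠ 0)

/-- `C_t`, the set of units without effect at time `t`. -/
def controls (P : Panel Ω N r) (T t : ℕ) : Finset (Fin N) :=
  open Classical in Finset.univ.filter fun i => P.β T t i = 0

/-- At least `⌊N/2⌋ + r` valid controls at each post-intervention time. -/
def MajorityControls (P : Panel Ω N r) : Prop :=
  ∀ T t, P.T0 T < t → t ≤ T → N / 2 + r ≤ (P.controls T t).card

/-- The centred process `(F_t - E F_t, ε_t)`. -/
def centred [MeasurableSpace Ω] (P : Panel Ω N r) (μ : Measure Ω) (T t : ℕ) (ω : Ω) :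
    (Fin r → ℝ) × (Fin N → ℝ) :=
  (P.F T t ω - P.factorMean μ T t, P.ε T t ω)

/-- The centred process is strictly stationary, with a law that does not change with the horizon,
has finite moments of order `4 + 2δ`, and is strongly mixing with
`∑ α(k) ^ (δ / (2 + δ)) < ∞`. -/
def StationaryMixing [MeasurableSpace Ω] (P : Panel Ω N r) (μ : Measure Ω) : Prop :=
  (∀ n T T' s s' : ℕ, s + n ≤ T → s' + n ≤ T' →
    IdentDistrib (fun ω (j : Fin n) => P.centred μ T (s + 1 + j) ω)
      (fun ω (j : Fin n) => P.centred μ T' (s' + 1 + j) ω) μ μ) ∧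
  ∃ δ : ℝ, 0 < δ ∧
    (∀ T t, 1 ≤ t → t ≤ T →
      (∀ k, MemLp (fun ω => (P.centred μ T t ω).1 k) (ENNReal.ofReal (4 + 2 * δ)) μ) ∧
      (∀ i, MemLp (fun ω => (P.centred μ T t ω).2 i) (ENNReal.ofReal (4 + 2 * δ)) μ)) ∧
    Summable fun k => mixingCoef μ (P.centred μ) k ^ (δ / (2 + δ))

/-- The Anderson–Rubin rank condition: after deleting any row of the loading matrix there remain
two disjoint `r × r` submatrices of rank `r`. -/
def AndersonRubin (P : Panel Ω N r) : Prop :=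
  ∀ i : Fin N, ∃ A B : Finset (Fin N), i ∉ A ∧ i ∉ B ∧ Disjoint A B ∧ A.card = r ∧ B.card = r ∧
    LinearIndependent ℝ (fun j : A => P.Λ.row j) ∧ LinearIndependent ℝ (fun j : B => P.Λ.row j)

/-- The loadings of the valid controls are in general position, as far as trimmed regression needs
it: the loadings of any `|C_t| + ⌊N/2⌋ + 1 - N` or more valid controls span `ℝ^r`. With at least
`⌊N/2⌋ + r` valid controls this number is at least `r`, so that the property holds in particular
when every `r` rows of the loading matrix are linearly independent. -/
def GeneralPosition (P : Panel Ω N r) : Prop :=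
  ∀ T t, P.T0 T < t → t ≤ T → ∀ S ⊆ P.controls T t,
    (P.controls T t).card + N / 2 + 1 ≤ N + S.card →
      Submodule.span ℝ (P.Λ.row '' (S : Set (Fin N))) = ⊤

/-- The trend `τ_t = β_t + Λ α_t`. -/
def trend [MeasurableSpace Ω] (P : Panel Ω N r) (μ : Measure Ω) (T t : ℕ) : Fin N → ℝ :=
  P.β T t + P.Λ.mulVec (P.factorMean μ T t)

/-- Mean of the pre-intervention outcomes. -/
def preMean (P : Panel Ω N r) (T : ℕ) (ω : Ω) : Fin N → ℝ :=
  (P.T0 T : ℝ)⁻¹ • ∑ t ∈ Finset.Icc 1 (P.T0 T), P.Y T t ω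

/-- `V̂`, the sample covariance matrix of the pre-intervention outcomes. -/
def preCov (P : Panel Ω N r) (T : ℕ) (ω : Ω) : Matrix (Fin N) (Fin N) ℝ :=
  (P.T0 T : ℝ)⁻¹ • ∑ t ∈ Finset.Icc 1 (P.T0 T),
    Matrix.vecMulVec (P.Y T t ω - P.preMean T ω) (P.Y T t ω - P.preMean T ω)

theorem preCov_isHermitian (P : Panel Ω N r) (T : ℕ) (ω : Ω) : (P.preCov T ω).IsHermitian := by
  ext i j
  simp [preCov, Matrix.sum_apply, Matrix.vecMulVec_apply, mul_comm]

/-- `σ̂ = (N⁻¹ ∑_{i = ⌈N/2⌉ - r}^N ν_i(V̂))^{1/2}`, with `ν_i` the `i`-th largest eigenvalue.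
Mathlib's `eigenvalues₀` lists the eigenvalues in decreasing order, starting at index `0`. -/
def sigmaHat (P : Panel Ω N r) (T : ℕ) (ω : Ω) : ℝ :=
  √((N : ℝ)⁻¹ * ∑ j : Fin (Fintype.card (Fin N)) with (N + 1) / 2 ≤ j.val + 1 + r,
    (P.preCov_isHermitian T ω).eigenvalues₀ j)

end Panel

/-- Negative Gaussian log-likelihood (up to constants) of the factor model with loadings `L` and
error variances `ψ`, at the sample covariance matrix `S`. -/
def factorObjective {N r : ℕ} (S : Matrix (Fin N) (Fin N) ℝ) (L : Matrix (Fin N) (Fin r) ℝ)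
    (ψ : Fin N → ℝ) : ℝ :=
  Real.log (L * L.transpose + Matrix.diagonal ψ).det +
    (S * (L * L.transpose + Matrix.diagonal ψ)⁻¹).trace

/-- `(L, ψ)` is a maximum likelihood solution of factor analysis at `S`, normalized so that
`Lᵀ diag(ψ)⁻¹ L` is diagonal. -/
def IsFactorMLE {N r : ℕ} (S : Matrix (Fin N) (Fin N) ℝ) (L : Matrix (Fin N) (Fin r) ℝ)
    (ψ : Fin N → ℝ) : Prop :=
  (∀ i, 0 < ψ i) ∧ (L.transpose * (Matrix.diagonal ψ)⁻¹ * L).IsDiag ∧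
  ∀ (L' : Matrix (Fin N) (Fin r) ℝ) (ψ' : Fin N → ℝ), (∀ i, 0 < ψ' i) →
    factorObjective S L ψ ≤ factorObjective S L' ψ'

/-- Sum of the `⌊N/2⌋ + 1` smallest squared residuals of the regression of `y` on `L`. -/
def ltsObjective {N r : ℕ} (L : Matrix (Fin N) (Fin r) ℝ) (y : Fin N → ℝ) (a : Fin r → ℝ) : ℝ :=
  let res : Fin N → ℝ := fun i => (y i - L.row i ⬝ᵥ a) ^ 2
  ∑ i : Fin N with i.val < N / 2 + 1, res (Tuple.sort res i)

/-- `a` is a least trimmed squares solution. -/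
def IsLTS {N r : ℕ} (L : Matrix (Fin N) (Fin r) ℝ) (y : Fin N → ℝ) (a : Fin r → ℝ) : Prop :=
  ∀ a', ltsObjective L y a ≤ ltsObjective L y a'

/-- The effect estimator `τ̂_t - Λ̂ α̂_t`. -/
def betaHat {N r : ℕ} (L : Matrix (Fin N) (Fin r) ℝ) (y : Fin N → ℝ) (a : Fin r → ℝ) :
    Fin N → ℝ :=
  y - L.mulVec a

/-- The hard-thresholding selection of units. -/
def selected {N r : ℕ} (L : Matrix (Fin N) (Fin r) ℝ) (y : Fin N → ℝ) (a : Fin r → ℝ)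
    (thr : ℝ) : Finset (Fin N) :=
  open Classical in Finset.univ.filter fun i => |y i - L.row i ⬝ᵥ a| ≤ thr

end SCI

end

/-
Apart from one probabilistic input the argument is deterministic. By Davydov's covariance
inequality the mixing condition makes the variance of a sample mean `O(1 / T₀)`, so the sample
covariance matrix is within `O_p(T ^ (-1 / 2))` of `V = Λ * Λᵀ + Σ`; together with the given rate
of the trend estimate, the inputs of all the estimators have a total error `e = O_p(T ^ (-d))`.

A likelihood minimizer `L * Lᵀ + Ψ` has to be within `O(e)` of `V`, as the Gaussian loss grows
quadratically away from its minimum. Each entry of `Σ` is a ratio of two minors of `V` whose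
denominator is nonzero by the Anderson–Rubin condition, so `Ψ` is within `O(e)` of `Σ`, and `L * Q`
is within `O(e)` of `Λ` for some invertible `Q`. Trimmed regression is equivariant under
`L ↦ L * Q`, so one may take `Q = 1`. More than half of the residuals at the trimmed minimizer are
`O(e)`, hence also those of enough controls to span the factor space: this bounds the coefficient
error, and with it the error of the estimated effects, by `O(e)`. Finally the noise level estimate
stays between two positive constants, so the selection threshold is of larger order than `e` but
tends to `0`, and separates the zero effects from the others.
-/

namespace SCI

section GaussianLoss

open Matrix
open scoped MatrixOrder

attribute [local instance] Matrix.normedAddCommGroup Matrix.normedSpace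

theorem norm_matrix_mul_le {l m n : Type*} [Fintype l] [Fintype m] [Fintype n]
    (A : Matrix l m ℝ) (B : Matrix m n ℝ) : ‖A * B‖ ≤ Fintype.card m * (‖A‖ * ‖B‖) := by
  refine (Matrix.norm_le_iff (by positivity)).mpr fun i j => ?_
  calc ‖(A * B) i j‖ ≤ ∑ k, ‖A i k * B k j‖ := norm_sum_le _ _
    _ ≤ ∑ _k : m, ‖A‖ * ‖B‖ := by
        gcongr with k
        rw [norm_mul]
        gcongr <;> exact Matrix.norm_entry_le_entrywise_sup_norm _
    _ = Fintype.card m * (‖A‖ * ‖B‖) := by simp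

variable {n : Type*} [Fintype n]

theorem norm_matrix_mul_mul_le (A B C : Matrix n n ℝ) :
    ‖A * B * C‖ ≤ (Fintype.card n : ℝ) ^ 2 * (‖A‖ * ‖B‖ * ‖C‖) := by
  calc ‖A * B * C‖ ≤ Fintype.card n * (Fintype.card n * (‖A‖ * ‖B‖) * ‖C‖) :=
        (norm_matrix_mul_le _ _).trans (by gcongr; exact norm_matrix_mul_le _ _)
    _ = (Fintype.card n : ℝ) ^ 2 * (‖A‖ * ‖B‖ * ‖C‖) := by ring

theorem abs_trace_le (X : Matrix n n ℝ) : |X.trace| ≤ Fintype.card n * ‖X‖ := by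
  calc |X.trace| ≤ ∑ i, |X i i| := Finset.abs_sum_le_sum_abs _ _
    _ ≤ ∑ _i : n, ‖X‖ := by gcongr; exact X.norm_entry_le_entrywise_sup_norm
    _ = Fintype.card n * ‖X‖ := by simp

variable [DecidableEq n]

theorem norm_conjStarAlgAut_le (U : unitaryGroup n ℝ) (X : Matrix n n ℝ) :
    ‖Unitary.conjStarAlgAut ℝ _ U X‖ ≤ (Fintype.card n : ℝ) ^ 2 * ‖X‖ := by
  have hU : ‖(U : Matrix n n ℝ)‖ ≤ 1 := entrywise_sup_norm_bound_of_unitary U.2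
  have hU' : ‖(star U : Matrix n n ℝ)‖ ≤ 1 := entrywise_sup_norm_bound_of_unitary (star U).2
  calc ‖(U : Matrix n n ℝ) * X * star (U : Matrix n n ℝ)‖
      ≤ (Fintype.card n : ℝ) ^ 2 * (1 * ‖X‖ * 1) :=
        (norm_matrix_mul_mul_le _ _ _).trans (by gcongr)
    _ = (Fintype.card n : ℝ) ^ 2 * ‖X‖ := by ring

theorem trace_conjStarAlgAut (U : unitaryGroup n ℝ) (X : Matrix n n ℝ) :
    (Unitary.conjStarAlgAut ℝ _ U X).trace = X.trace := by
  rw [Unitary.conjStarAlgAut_apply, trace_mul_comm, ← Matrix.mul_assoc, Unitary.coe_star_mul_self,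
    Matrix.one_mul]

/-- Up to constants and a factor, the negative Gaussian log-likelihood of the covariance matrix `M`
at the sample covariance matrix `S`; factor analysis minimizes it over the matrices
`L * Lᵀ + diagonal ψ`. -/
noncomputable def gaussianLoss (S M : Matrix n n ℝ) : ℝ :=
  Real.log M.det + (S * M⁻¹).trace

theorem gaussianLoss_conj {A S M : Matrix n n ℝ} (hA : IsUnit A) (hM : M.PosDef) :
    gaussianLoss (A * S * Aᵀ) (A * M * Aᵀ) = Real.log (A.det ^ 2) + gaussianLoss S M := by
  have hA0 : A.det ≠ 0 := ((isUnit_iff_isUnit_det A).mp hA).ne_zero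
  have hdet : (A * M * Aᵀ).det = A.det ^ 2 * M.det := by
    rw [det_mul, det_mul, det_transpose]; ring
  have htr : (A * S * Aᵀ * (A * M * Aᵀ)⁻¹).trace = (S * M⁻¹).trace := by
    have hAt : Aᵀ * (Aᵀ)⁻¹ = 1 := mul_nonsing_inv _ (by simpa using hA0)
    have hA' : A⁻¹ * A = 1 := nonsing_inv_mul _ (by simpa using hA0)
    calc (A * S * Aᵀ * (A * M * Aᵀ)⁻¹).trace
        = (A * (S * (Aᵀ * (Aᵀ)⁻¹) * M⁻¹) * A⁻¹).trace := by
          simp only [Matrix.mul_inv_rev, Matrix.mul_assoc]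
      _ = (A⁻¹ * A * (S * M⁻¹)).trace := by
          rw [hAt, Matrix.mul_one, trace_mul_comm, Matrix.mul_assoc]
      _ = (S * M⁻¹).trace := by rw [hA', Matrix.one_mul]
  rw [gaussianLoss, gaussianLoss, hdet, htr, Real.log_mul (pow_ne_zero 2 hA0) hM.det_pos.ne']
  ring

theorem inv_sub_one_eq_conjStarAlgAut {H : Matrix n n ℝ} (hH : H.PosDef) :
    H⁻¹ - 1 = Unitary.conjStarAlgAut ℝ _ hH.1.eigenvectorUnitary
      (diagonal fun k => (hH.1.eigenvalues k)⁻¹ - 1) := by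
  have hinv : H⁻¹ = Unitary.conjStarAlgAut ℝ _ hH.1.eigenvectorUnitary
      (diagonal fun k => (hH.1.eigenvalues k)⁻¹) := by
    refine inv_eq_right_inv ?_
    nth_rewrite 1 [hH.1.spectral_theorem]
    rw [← map_mul, diagonal_mul_diagonal]
    simp [(hH.eigenvalues_pos _).ne']
  rw [hinv, ← map_one (Unitary.conjStarAlgAut ℝ _ hH.1.eigenvectorUnitary), ← map_sub,
    ← diagonal_one, diagonal_sub]

theorem gaussianLoss_sub_one {E H : Matrix n n ℝ} (hH : H.PosDef) :
    gaussianLoss (1 + E) H - gaussianLoss (1 + E) 1 =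
      (∑ k, ((hH.1.eigenvalues k)⁻¹ - 1 - Real.log (hH.1.eigenvalues k)⁻¹)) +
        (E * (H⁻¹ - 1)).trace := by
  have hlog : Real.log H.det = -∑ k, Real.log (hH.1.eigenvalues k)⁻¹ := by
    rw [hH.1.det_eq_prod_eigenvalues]
    simp [Real.log_prod fun k _ => (hH.eigenvalues_pos k).ne', Real.log_inv]
  have htr : (H⁻¹ - 1).trace = ∑ k, ((hH.1.eigenvalues k)⁻¹ - 1) := by
    rw [inv_sub_one_eq_conjStarAlgAut hH, trace_conjStarAlgAut, trace_diagonal]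
  have hsplit : (1 + E) * H⁻¹ = (1 + E) + (H⁻¹ - 1) + E * (H⁻¹ - 1) := by
    noncomm_ring
  rw [gaussianLoss, gaussianLoss, hsplit, inv_one, Matrix.mul_one, det_one, Real.log_one, hlog,
    trace_add, trace_add, htr]
  simp only [Finset.sum_sub_distrib]
  ring

theorem sq_sqrt_sub_one_le {g : ℝ} (hg : 0 < g) : (√g - 1) ^ 2 ≤ g - 1 - Real.log g := by
  have hs : 0 < √g := Real.sqrt_pos.mpr hg
  have hlog : Real.log g = 2 * Real.log √g := by rw [Real.log_sqrt hg.le]; ring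
  linarith [Real.log_le_sub_one_of_pos hs, Real.sq_sqrt hg.le]

theorem sum_le_of_sum_sq_le {ι : Type*} [Fintype ι] {u : ι → ℝ} (hu : ∀ i, 0 ≤ u i) {κ : ℝ}
    (hκ0 : 0 ≤ κ) (hκ : κ ≤ 1 / 2) (h : ∑ i, u i ^ 2 ≤ κ * ∑ i, u i * (u i + 2)) :
    ∑ i, u i ≤ 4 * κ * Fintype.card ι := by
  have hs : 0 ≤ ∑ i, u i := Finset.sum_nonneg fun i _ => hu i
  have hexpand : ∑ i, u i * (u i + 2) = ∑ i, u i ^ 2 + 2 * ∑ i, u i := by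
    rw [Finset.mul_sum, ← Finset.sum_add_distrib]
    exact Finset.sum_congr rfl fun i _ => by ring
  have hsq : ∑ i, u i ^ 2 ≤ 4 * κ * ∑ i, u i := by
    have hq : 0 ≤ ∑ i, u i ^ 2 := Finset.sum_nonneg fun i _ => sq_nonneg _
    rw [hexpand] at h
    nlinarith
  have hcs : (∑ i, u i) * ∑ i, u i ≤ 4 * κ * Fintype.card ι * ∑ i, u i := by
    calc (∑ i, u i) * ∑ i, u i = (∑ i, u i) ^ 2 := (sq _).symm
      _ ≤ Fintype.card ι * ∑ i, u i ^ 2 := by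
          simpa using sq_sum_le_card_mul_sum_sq (s := Finset.univ) (f := u)
      _ ≤ Fintype.card ι * (4 * κ * ∑ i, u i) := by gcongr
      _ = 4 * κ * Fintype.card ι * ∑ i, u i := by ring
  rcases hs.eq_or_lt with h0 | h0
  · rw [← h0]
    positivity
  · exact le_of_mul_le_mul_right hcs h0

theorem abs_inv_sub_one_le {g : ℝ} (hg : 0 < g) (hu : |√g - 1| ≤ 1 / 2) :
    |g⁻¹ - 1| ≤ 10 * |√g - 1| := by
  have hs : 1 / 2 ≤ √g := by linarith [(abs_le.mp hu).1]
  have hsq := Real.sq_sqrt hg.le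
  have hfactor : g⁻¹ - 1 = -(g⁻¹ * ((√g - 1) * (√g - 1 + 2))) := by
    field_simp
    linarith
  have hinv : g⁻¹ ≤ 4 := by
    rw [inv_le_comm₀ hg (by norm_num)]
    nlinarith
  have hlin : |√g - 1 + 2| ≤ 5 / 2 := by
    rw [abs_of_pos (by linarith)]
    linarith [(abs_le.mp hu).2]
  rw [hfactor, abs_neg, abs_mul, abs_mul, abs_of_pos (inv_pos.mpr hg)]
  calc g⁻¹ * (|√g - 1| * |√g - 1 + 2|) ≤ 4 * (|√g - 1| * (5 / 2)) := by gcongr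
    _ = 10 * |√g - 1| := by ring

/-- The entropy-type sum on the left is quadratic in the deviations of `g` from `1`, so a small
multiple of their sum can only bound it if all of them are small. -/
theorem abs_inv_sub_one_le_of_sum_sub_log_le {ι : Type*} [Fintype ι] {g : ι → ℝ}
    (hg : ∀ i, 0 < g i) {κ : ℝ} (hκ0 : 0 ≤ κ) (hκ : κ ≤ 1 / 2)
    (hκι : 4 * κ * Fintype.card ι ≤ 1 / 2)
    (h : ∑ i, (g i - 1 - Real.log (g i)) ≤ κ * ∑ i, |g i - 1|) (i : ι) :
    |(g i)⁻¹ - 1| ≤ 40 * κ * Fintype.card ι := by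
  have hdev : ∀ i, |g i - 1| ≤ |√(g i) - 1| * (|√(g i) - 1| + 2) := fun i => by
    have hfactor : g i - 1 = (√(g i) - 1) * (√(g i) - 1 + 2) := by
      linarith [Real.sq_sqrt (hg i).le]
    rw [hfactor, abs_mul]
    gcongr
    exact (abs_add_le _ _).trans_eq (by norm_num)
  have hsum : ∑ i, |√(g i) - 1| ≤ 4 * κ * Fintype.card ι := by
    refine sum_le_of_sum_sq_le (fun _ => abs_nonneg _) hκ0 hκ ?_
    calc ∑ i, |√(g i) - 1| ^ 2 ≤ ∑ i, (g i - 1 - Real.log (g i)) := by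
          gcongr with i
          rw [sq_abs]
          exact sq_sqrt_sub_one_le (hg i)
      _ ≤ κ * ∑ i, |g i - 1| := h
      _ ≤ κ * ∑ i, |√(g i) - 1| * (|√(g i) - 1| + 2) := by gcongr with i; exact hdev i
  have hi : |√(g i) - 1| ≤ 4 * κ * Fintype.card ι :=
    (Finset.single_le_sum (f := fun i => |√(g i) - 1|) (fun _ _ => abs_nonneg _)
      (Finset.mem_univ i)).trans hsum
  exact (abs_inv_sub_one_le (hg i) (hi.trans hκι)).trans (by linarith)

theorem exists_norm_sub_one_le_of_gaussianLoss_le (n : Type*) [Fintype n] [DecidableEq n] :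
    ∃ C ε₀ : ℝ, 0 ≤ C ∧ 0 < ε₀ ∧ ∀ H E : Matrix n n ℝ, H.PosDef → ‖E‖ ≤ ε₀ →
      gaussianLoss (1 + E) H ≤ gaussianLoss (1 + E) 1 → ‖H - 1‖ ≤ C * ‖E‖ := by
  set N := (Fintype.card n : ℝ)
  have : 0 ≤ N := Nat.cast_nonneg _
  refine ⟨40 * N ^ 7, 1 / (8 * N ^ 5 + 8 * N ^ 4 + 1), by positivity, by positivity,
    fun H E hH hE hle => ?_⟩
  rw [le_div_iff₀ (by positivity)] at hE
  have hE4 : 0 ≤ N ^ 4 * ‖E‖ := by positivity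
  have hE5 : 0 ≤ N ^ 5 * ‖E‖ := by positivity
  set h := hH.1.eigenvalues
  have hnorm : ‖H⁻¹ - 1‖ ≤ N ^ 2 * ∑ k, |(h k)⁻¹ - 1| := by
    rw [inv_sub_one_eq_conjStarAlgAut hH]
    refine (norm_conjStarAlgAut_le _ _).trans ?_
    rw [norm_diagonal]
    gcongr
    exact (pi_norm_le_iff_of_nonneg (by positivity)).mpr fun k =>
      Finset.single_le_sum (f := fun k => |(h k)⁻¹ - 1|) (fun _ _ => abs_nonneg _)
        (Finset.mem_univ k)
  have htrace : |(E * (H⁻¹ - 1)).trace| ≤ N ^ 4 * ‖E‖ * ∑ k, |(h k)⁻¹ - 1| := by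
    calc |(E * (H⁻¹ - 1)).trace| ≤ N * (N * (‖E‖ * (N ^ 2 * ∑ k, |(h k)⁻¹ - 1|))) :=
          (abs_trace_le _).trans (by
            gcongr
            exact (norm_matrix_mul_le _ _).trans (by gcongr))
      _ = N ^ 4 * ‖E‖ * ∑ k, |(h k)⁻¹ - 1| := by ring
  have hsum : ∑ k, ((h k)⁻¹ - 1 - Real.log (h k)⁻¹) ≤ N ^ 4 * ‖E‖ * ∑ k, |(h k)⁻¹ - 1| := by
    linarith [gaussianLoss_sub_one (E := E) hH, neg_abs_le (E * (H⁻¹ - 1)).trace]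
  have hdev : ∀ k, |h k - 1| ≤ 40 * (N ^ 4 * ‖E‖) * N := fun k => by
    simpa using abs_inv_sub_one_le_of_sum_sub_log_le
      (fun k => inv_pos.mpr (hH.eigenvalues_pos k)) hE4 (by linarith [norm_nonneg E])
      (by linarith [norm_nonneg E]) hsum k
  have hspec : H - 1 = Unitary.conjStarAlgAut ℝ _ hH.1.eigenvectorUnitary
      (diagonal fun k => h k - 1) := by
    nth_rewrite 1 [hH.1.spectral_theorem]
    rw [← map_one (Unitary.conjStarAlgAut ℝ _ hH.1.eigenvectorUnitary), ← map_sub,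
      ← diagonal_one, diagonal_sub]
    rfl
  rw [hspec]
  refine (norm_conjStarAlgAut_le _ _).trans ?_
  rw [norm_diagonal]
  calc N ^ 2 * ‖fun k => h k - 1‖ ≤ N ^ 2 * (40 * (N ^ 4 * ‖E‖) * N) := by
        gcongr
        exact (pi_norm_le_iff_of_nonneg (by positivity)).mpr hdev
    _ = 40 * N ^ 7 * ‖E‖ := by ring

theorem exists_norm_sub_le_of_gaussianLoss_le {V : Matrix n n ℝ} (hV : V.PosDef) :
    ∃ C ε₀ : ℝ, 0 ≤ C ∧ 0 < ε₀ ∧ ∀ M S : Matrix n n ℝ, M.PosDef → ‖S - V‖ ≤ ε₀ →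
      gaussianLoss S M ≤ gaussianLoss S V → ‖M - V‖ ≤ C * ‖S - V‖ := by
  obtain ⟨C, ε₀, hC, hε₀, hbound⟩ := exists_norm_sub_one_le_of_gaussianLoss_le n
  obtain ⟨A, hA, hVA : V = A * Aᵀ⟩ :=
    CStarAlgebra.isStrictlyPositive_iff_eq_mul_star_self.mp hV.isStrictlyPositive
  have hdetA : IsUnit A.det := (isUnit_iff_isUnit_det A).mp hA
  -- Whitening by `A⁻¹` reduces the claim to `V = 1`.
  have hwhiten : ∀ X : Matrix n n ℝ, A * (A⁻¹ * X * A⁻¹ᵀ) * Aᵀ = X := fun X => by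
    calc A * (A⁻¹ * X * A⁻¹ᵀ) * Aᵀ = (A * A⁻¹) * X * (A * A⁻¹)ᵀ := by
          simp only [transpose_mul, Matrix.mul_assoc]
      _ = X := by rw [mul_nonsing_inv _ hdetA]; simp
  set N := (Fintype.card n : ℝ)
  set b : ℝ := N ^ 2 * (‖A⁻¹‖ * ‖A⁻¹ᵀ‖)
  set a : ℝ := N ^ 2 * (‖A‖ * ‖Aᵀ‖)
  refine ⟨a * (C * b), ε₀ / (b + 1), by positivity, by positivity, fun M S hM hS hle => ?_⟩
  set H := A⁻¹ * M * A⁻¹ᵀ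
  set E := A⁻¹ * (S - V) * A⁻¹ᵀ
  have hH : H.PosDef := by
    refine hM.mul_mul_conjTranspose_same (B := A⁻¹) fun x y hxy => ?_
    simpa [vecMul_vecMul, nonsing_inv_mul _ hdetA] using congrArg (fun z => z ᵥ* A) hxy
  have hMH : A * H * Aᵀ = M := hwhiten M
  have hSE : A * (1 + E) * Aᵀ = S := by
    rw [Matrix.mul_add, Matrix.add_mul, hwhiten, Matrix.mul_one, ← hVA, add_sub_cancel]
  have hV1 : A * 1 * Aᵀ = V := by rw [Matrix.mul_one, hVA]
  have hE : ‖E‖ ≤ b * ‖S - V‖ := (norm_matrix_mul_mul_le _ _ _).trans_eq (by ring)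
  have hEε : ‖E‖ ≤ ε₀ := by
    rw [le_div_iff₀ (by positivity)] at hS
    linarith [norm_nonneg (S - V)]
  have hle' : gaussianLoss (1 + E) H ≤ gaussianLoss (1 + E) 1 := by
    rwa [← hMH, ← hSE, ← hV1, gaussianLoss_conj hA hH, gaussianLoss_conj hA .one,
      add_le_add_iff_left] at hle
  have hMV : M - V = A * (H - 1) * Aᵀ := by
    rw [Matrix.mul_sub, Matrix.sub_mul, hMH, hV1]
  calc ‖M - V‖ ≤ N ^ 2 * (‖A‖ * (C * (b * ‖S - V‖)) * ‖Aᵀ‖) := by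
        rw [hMV]
        refine (norm_matrix_mul_mul_le _ _ _).trans ?_
        gcongr
        exact (hbound H E hH hEε hle').trans (by gcongr)
    _ = a * (C * b) * ‖S - V‖ := by ring

end GaussianLoss

section Identification

open Matrix

attribute [local instance] Matrix.normedAddCommGroup Matrix.normedSpace

theorem differentiable_det {m : Type*} [Fintype m] [DecidableEq m] :
    Differentiable ℝ (fun M : Matrix m m ℝ => M.det) := by
  have : ∀ i j : m, Differentiable ℝ (fun M : Matrix m m ℝ => M i j) := fun i j =>
    differentiable_pi.mp (differentiable_pi.mp differentiable_id i) j
  simp only [det_apply']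
  fun_prop

theorem det_mul_eq_zero_of_card_lt {R l m : Type*} [Field R] [Fintype l] [DecidableEq l]
    [Fintype m] (h : Fintype.card m < Fintype.card l) (X : Matrix l m R) (Y : Matrix m l R) :
    (X * Y).det = 0 := by
  by_contra hdet
  have hrank : (X * Y).rank = Fintype.card l :=
    rank_of_isUnit _ ((isUnit_iff_isUnit_det _).mpr (Ne.isUnit hdet))
  exact absurd ((rank_mul_le_left X Y).trans X.rank_le_card_width) (by omega)

variable {n : Type*} {r : ℕ}

theorem submatrix_mul_transpose_add_diagonal [DecidableEq n] {l m : Type*}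
    (L : Matrix n (Fin r) ℝ) (ψ : n → ℝ) {f : l → n} {g : m → n} (hfg : ∀ a b, f a ≠ g b) :
    (L * Lᵀ + diagonal ψ).submatrix f g = L.submatrix f id * (L.submatrix g id)ᵀ := by
  ext a b
  simp [mul_apply, diagonal_apply_ne _ (hfg a b)]

theorem det_bordered_minor [DecidableEq n] (L : Matrix n (Fin r) ℝ) (ψ : n → ℝ)
    {i : n} {f g : Fin r → n} (hf : ∀ a, f a ≠ i) (hg : ∀ a, g a ≠ i) (hfg : ∀ a b, f a ≠ g b) :
    ((L * Lᵀ + diagonal ψ).submatrix (Fin.cons i f : Fin (r + 1) → n) (Fin.cons i g)).det =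
      ψ i * ((L * Lᵀ + diagonal ψ).submatrix f g).det := by
  set M := L * Lᵀ + diagonal ψ with hM
  set X := M.submatrix (Fin.cons i f : Fin (r + 1) → n) (Fin.cons i g) with hX
  set K := L.submatrix (Fin.cons i f : Fin (r + 1) → n) id *
    (L.submatrix (Fin.cons i g : Fin (r + 1) → n) id)ᵀ with hK
  -- `X` and the singular matrix `K` differ in the corner entry only; expand both along row `0`.
  have hKdet : K.det = 0 := det_mul_eq_zero_of_card_lt (by simp) _ _
  have hcorner : X 0 0 = K 0 0 + ψ i := by simp [hX, hK, hM, mul_apply]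
  have hrow : ∀ b : Fin r, X 0 b.succ = K 0 b.succ := fun b => by
    simp [hX, hK, hM, mul_apply, diagonal_apply_ne _ (hg b).symm]
  have hbelow : ∀ (a : Fin r) (j : Fin (r + 1)), X a.succ j = K a.succ j := fun a j => by
    refine Fin.cases ?_ (fun b => ?_) j
    · simp [hX, hK, hM, mul_apply, diagonal_apply_ne _ (hf a)]
    · simp [hX, hK, hM, mul_apply, diagonal_apply_ne _ (hfg a b)]
  have hminor : ∀ j : Fin (r + 1),
      X.submatrix Fin.succ j.succAbove = K.submatrix Fin.succ j.succAbove := fun j => by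
    ext a b
    exact hbelow a _
  have hXfg : X.submatrix Fin.succ (Fin.succAbove 0) = M.submatrix f g := by
    ext a b
    simp [hX]
  have hdetX := det_succ_row_zero X
  have hdetK := det_succ_row_zero K
  rw [Fin.sum_univ_succ] at hdetX hdetK
  simp only [hcorner, hrow, hminor] at hdetX
  rw [hKdet] at hdetK
  rw [hdetX, ← hXfg, hminor]
  simp only [Fin.val_zero, pow_zero, one_mul] at hdetK ⊢
  linear_combination -hdetK

/-- A bordered minor divided by the minor that it borders. It recovers the unique variance `ψ i`
from the covariance matrix `L * Lᵀ + diagonal ψ` of a factor model. -/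
noncomputable def borderedMinorRatio (i : n) (f g : Fin r → n) (M : Matrix n n ℝ) : ℝ :=
  (M.submatrix (Fin.cons i f : Fin (r + 1) → n) (Fin.cons i g)).det / (M.submatrix f g).det

theorem borderedMinorRatio_mul_transpose_add_diagonal [DecidableEq n] (L : Matrix n (Fin r) ℝ)
    (ψ : n → ℝ) {i : n} {f g : Fin r → n} (hf : ∀ a, f a ≠ i) (hg : ∀ a, g a ≠ i)
    (hfg : ∀ a b, f a ≠ g b)
    (hdet : ((L * Lᵀ + diagonal ψ).submatrix f g).det ≠ 0) :
    borderedMinorRatio i f g (L * Lᵀ + diagonal ψ) = ψ i := by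
  rw [borderedMinorRatio, det_bordered_minor L ψ hf hg hfg, mul_div_cancel_right₀ _ hdet]

/-- The Anderson–Rubin rank condition on a matrix: after deleting any row there remain two disjoint
square submatrices of full column rank. -/
def AndersonRubinCondition (Λ : Matrix n (Fin r) ℝ) : Prop :=
  ∀ i : n, ∃ A B : Finset n, i ∉ A ∧ i ∉ B ∧ Disjoint A B ∧ A.card = r ∧ B.card = r ∧
    LinearIndependent ℝ (fun j : A => Λ.row j) ∧ LinearIndependent ℝ (fun j : B => Λ.row j)

theorem exists_det_submatrix_ne_zero {Λ : Matrix n (Fin r) ℝ} {A : Finset n} (hA : A.card = r)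
    (hli : LinearIndependent ℝ (fun j : A => Λ.row j)) :
    ∃ f : Fin r → n, (∀ a, f a ∈ A) ∧ (Λ.submatrix f id).det ≠ 0 := by
  let e : Fin r ≃ A := (finCongr hA.symm).trans A.equivFin.symm
  have hrow : LinearIndependent ℝ (Λ.submatrix (fun a => (e a : n)) id).row :=
    hli.comp e e.injective
  exact ⟨fun a => e a, fun a => (e a).2,
    ((isUnit_iff_isUnit_det _).mp (linearIndependent_rows_iff_isUnit.mp hrow)).ne_zero⟩

namespace AndersonRubinCondition

variable [DecidableEq n] {Λ : Matrix n (Fin r) ℝ}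

theorem exists_det_submatrix_mul_transpose_ne_zero (hΛ : AndersonRubinCondition Λ) (s : n → ℝ)
    (i : n) :
    ∃ f g : Fin r → n, (∀ a, f a ≠ i) ∧ (∀ a, g a ≠ i) ∧ (∀ a b, f a ≠ g b) ∧
      (Λ.submatrix f id).det ≠ 0 ∧ ((Λ * Λᵀ + diagonal s).submatrix f g).det ≠ 0 := by
  obtain ⟨A, B, hiA, hiB, hAB, hA, hB, hliA, hliB⟩ := hΛ i
  obtain ⟨f, hfA, hf⟩ := exists_det_submatrix_ne_zero hA hliA
  obtain ⟨g, hgB, hg⟩ := exists_det_submatrix_ne_zero hB hliB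
  have hfg : ∀ a b, f a ≠ g b := fun a b h => Finset.disjoint_left.mp hAB (hfA a) (h ▸ hgB b)
  refine ⟨f, g, fun a h => hiA (h ▸ hfA a), fun a h => hiB (h ▸ hgB a), hfg, hf, ?_⟩
  rw [submatrix_mul_transpose_add_diagonal Λ s hfg, det_mul, det_transpose]
  exact mul_ne_zero hf hg

end AndersonRubinCondition

theorem differentiable_submatrix [Finite n] {l m : Type*} [Finite l] [Finite m] (f : l → n)
    (g : m → n) : Differentiable ℝ (fun M : Matrix n n ℝ => M.submatrix f g) := by
  have := Fintype.ofFinite n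
  have := Fintype.ofFinite l
  have := Fintype.ofFinite m
  exact differentiable_pi.mpr fun i => differentiable_pi.mpr fun j =>
    differentiable_pi.mp (differentiable_pi.mp differentiable_id (f i)) (g j)

theorem differentiableAt_borderedMinorRatio [Finite n] (i : n) {f g : Fin r → n}
    {M : Matrix n n ℝ} (hdet : (M.submatrix f g).det ≠ 0) :
    DifferentiableAt ℝ (borderedMinorRatio i f g) M := by
  have := Fintype.ofFinite n
  have hminor : Differentiable ℝ fun X : Matrix n n ℝ => (X.submatrix f g).det :=
    differentiable_det.comp (differentiable_submatrix f g)
  have hbordered : Differentiable ℝ fun X : Matrix n n ℝ =>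
      (X.submatrix (Fin.cons i f : Fin (r + 1) → n) (Fin.cons i g)).det :=
    differentiable_det.comp (differentiable_submatrix _ _)
  exact (hbordered M).fun_mul ((hminor M).fun_inv hdet)

theorem eventually_det_submatrix_ne_zero {V : Matrix n n ℝ} {f g : Fin r → n}
    (hdet : (V.submatrix f g).det ≠ 0) : ∀ᶠ M in 𝓝 V, (M.submatrix f g).det ≠ 0 :=
  (continuous_id.matrix_submatrix f g).matrix_det.continuousAt.eventually_ne hdet

variable [Fintype n] [DecidableEq n] {Λ : Matrix n (Fin r) ℝ}

namespace AndersonRubinCondition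

theorem eventually_norm_unique_variance_sub_le (hΛ : AndersonRubinCondition Λ) (s : n → ℝ) :
    ∃ C : ℝ, 0 ≤ C ∧ ∀ᶠ M in 𝓝 (Λ * Λᵀ + diagonal s), ∀ (L : Matrix n (Fin r) ℝ) (ψ : n → ℝ),
      L * Lᵀ + diagonal ψ = M → ‖ψ - s‖ ≤ C * ‖M - (Λ * Λᵀ + diagonal s)‖ := by
  set V := Λ * Λᵀ + diagonal s
  choose f g hf hg hfg _ hdet using hΛ.exists_det_submatrix_mul_transpose_ne_zero s
  have hdiff : DifferentiableAt ℝ (fun M i => borderedMinorRatio i (f i) (g i) M) V :=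
    differentiableAt_pi.mpr fun i => differentiableAt_borderedMinorRatio i (hdet i)
  obtain ⟨C, hC, hbound⟩ := hdiff.isBigO_sub.exists_nonneg
  refine ⟨C, hC, ?_⟩
  filter_upwards [hbound.bound, eventually_all.mpr fun i =>
    eventually_det_submatrix_ne_zero (hdet i)] with M hM hdetM L ψ hL
  subst hL
  have hψ : (fun i => borderedMinorRatio i (f i) (g i) (L * Lᵀ + diagonal ψ)) = ψ := funext fun i =>
    borderedMinorRatio_mul_transpose_add_diagonal L ψ (hf i) (hg i) (hfg i) (hdetM i)
  have hs : (fun i => borderedMinorRatio i (f i) (g i) V) = s := funext fun i =>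
    borderedMinorRatio_mul_transpose_add_diagonal Λ s (hf i) (hg i) (hfg i) (hdet i)
  rwa [hψ, hs] at hM

theorem norm_mul_transpose_mul_inv_sub_le (L : Matrix n (Fin r) ℝ) (ψ s : n → ℝ) {f : Fin r → n}
    (hf : (Λ.submatrix f id).det ≠ 0) :
    ‖L * ((L.submatrix f id)ᵀ * (Λ.submatrix f id)ᵀ⁻¹) - Λ‖ ≤
      r * ((‖L * Lᵀ + diagonal ψ - (Λ * Λᵀ + diagonal s)‖ + ‖ψ - s‖) *
        ‖(Λ.submatrix f id)ᵀ⁻¹‖) := by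
  set D := (L * Lᵀ + diagonal ψ - (Λ * Λᵀ + diagonal s)) - diagonal (ψ - s)
  have hcancel : (Λ.submatrix f id)ᵀ * (Λ.submatrix f id)ᵀ⁻¹ = 1 :=
    mul_nonsing_inv _ (by rw [det_transpose]; exact hf.isUnit)
  have hcolumns : L * (L.submatrix f id)ᵀ - Λ * (Λ.submatrix f id)ᵀ = D.submatrix id f := by
    ext a b
    simp [D, mul_apply, diagonal_apply]
    split_ifs <;> ring
  have hD : ‖D.submatrix id f‖ ≤
      ‖L * Lᵀ + diagonal ψ - (Λ * Λᵀ + diagonal s)‖ + ‖ψ - s‖ := by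
    refine (norm_le_iff (by positivity)).mpr fun a b => ?_
    calc ‖D a (f b)‖ ≤ ‖D‖ := norm_entry_le_entrywise_sup_norm _
      _ ≤ _ := (norm_sub_le _ _).trans_eq (by rw [norm_diagonal])
  calc ‖L * ((L.submatrix f id)ᵀ * (Λ.submatrix f id)ᵀ⁻¹) - Λ‖
      = ‖D.submatrix id f * (Λ.submatrix f id)ᵀ⁻¹‖ := by
        rw [← hcolumns, Matrix.sub_mul, Matrix.mul_assoc, Matrix.mul_assoc, hcancel,
          Matrix.mul_one]
    _ ≤ r * (‖D.submatrix id f‖ * ‖(Λ.submatrix f id)ᵀ⁻¹‖) := by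
        simpa using norm_matrix_mul_le (D.submatrix id f) (Λ.submatrix f id)ᵀ⁻¹
    _ ≤ _ := by gcongr

theorem eventually_exists_norm_loadings_sub_le (hΛ : AndersonRubinCondition Λ) (s : n → ℝ) :
    ∃ C : ℝ, 0 ≤ C ∧ ∀ᶠ M in 𝓝 (Λ * Λᵀ + diagonal s), ∀ (L : Matrix n (Fin r) ℝ) (ψ : n → ℝ),
      L * Lᵀ + diagonal ψ = M → ∃ Q : Matrix (Fin r) (Fin r) ℝ, IsUnit Q.det ∧
        ‖L * Q - Λ‖ ≤ C * ‖M - (Λ * Λᵀ + diagonal s)‖ := by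
  rcases isEmpty_or_nonempty n with _ | ⟨⟨i⟩⟩
  · exact ⟨0, le_rfl, .of_forall fun M L ψ _ =>
      ⟨1, by simp, by simp [Subsingleton.elim (L * (1 : Matrix (Fin r) (Fin r) ℝ)) Λ]⟩⟩
  obtain ⟨C, hC, hψ⟩ := hΛ.eventually_norm_unique_variance_sub_le s
  obtain ⟨f, g, -, -, hfg, hf, hdet⟩ := hΛ.exists_det_submatrix_mul_transpose_ne_zero s i
  refine ⟨r * ((1 + C) * ‖(Λ.submatrix f id)ᵀ⁻¹‖), by positivity, ?_⟩
  filter_upwards [hψ, eventually_det_submatrix_ne_zero hdet] with M hψM hdetM L ψ hL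
  have hLf : (L.submatrix f id).det ≠ 0 := by
    rw [← hL, submatrix_mul_transpose_add_diagonal L ψ hfg, det_mul] at hdetM
    exact left_ne_zero_of_mul hdetM
  refine ⟨(L.submatrix f id)ᵀ * (Λ.submatrix f id)ᵀ⁻¹, ?_, ?_⟩
  · rw [det_mul, det_nonsing_inv, det_transpose, det_transpose]
    exact hLf.isUnit.mul hf.isUnit.ringInverse
  · refine (norm_mul_transpose_mul_inv_sub_le L ψ s hf).trans ?_
    rw [hL]
    calc r * ((‖M - (Λ * Λᵀ + diagonal s)‖ + ‖ψ - s‖) * ‖(Λ.submatrix f id)ᵀ⁻¹‖)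
        ≤ r * ((‖M - (Λ * Λᵀ + diagonal s)‖ + C * ‖M - (Λ * Λᵀ + diagonal s)‖) *
            ‖(Λ.submatrix f id)ᵀ⁻¹‖) := by gcongr; exact hψM L ψ hL
      _ = _ := by ring

end AndersonRubinCondition

end Identification

section MaximumLikelihood

open Matrix

attribute [local instance] Matrix.normedAddCommGroup Matrix.normedSpace

theorem posDef_mul_transpose_add_diagonal {n m : Type*} [Finite n] [DecidableEq n] [Fintype m]
    (L : Matrix n m ℝ) {ψ : n → ℝ} (hψ : ∀ i, 0 < ψ i) : (L * Lᵀ + diagonal ψ).PosDef :=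
  PosDef.posSemidef_add (by simpa using posSemidef_self_mul_conjTranspose L) (PosDef.diagonal hψ)

theorem continuousAt_matrix_inv {n : Type*} [Fintype n] [DecidableEq n] {M : Matrix n n ℝ}
    (hM : M.det ≠ 0) : ContinuousAt (fun X : Matrix n n ℝ => X⁻¹) M := by
  simp only [inv_def, Ring.inverse_eq_inv']
  exact ((Continuous.matrix_det continuous_id).continuousAt.inv₀ hM).smul
    (Continuous.matrix_adjugate continuous_id).continuousAt

variable {n : Type*} [Fintype n] [DecidableEq n] {r : ℕ}

theorem continuousAt_gaussianLoss (S : Matrix n n ℝ) {M : Matrix n n ℝ} (hM : M.det ≠ 0) :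
    ContinuousAt (gaussianLoss S) M := by
  have htrace : Continuous (fun X : Matrix n n ℝ => (S * X).trace) := by fun_prop
  exact ((Continuous.matrix_det continuous_id).continuousAt.log hM).add
    (htrace.continuousAt.comp (continuousAt_matrix_inv hM))

theorem norm_sq_le_norm_mul_transpose_add_diagonal (L : Matrix n (Fin r) ℝ) {ψ : n → ℝ}
    (hψ : ∀ i, 0 ≤ ψ i) : ‖L‖ ^ 2 ≤ ‖L * Lᵀ + diagonal ψ‖ := by
  refine (Real.le_sqrt (norm_nonneg _) (norm_nonneg _)).mp
    ((norm_le_iff (by positivity)).mpr fun i k => Real.le_sqrt_of_sq_le ?_)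
  calc ‖L i k‖ ^ 2 = L i k ^ 2 := sq_abs _
    _ ≤ ∑ l, L i l ^ 2 :=
        Finset.single_le_sum (f := fun l => L i l ^ 2) (fun _ _ => sq_nonneg _) (Finset.mem_univ k)
    _ ≤ (L * Lᵀ + diagonal ψ) i i := by simp [mul_apply, ← sq, hψ i]
    _ ≤ ‖L * Lᵀ + diagonal ψ‖ := (le_abs_self _).trans
        (norm_entry_le_entrywise_sup_norm (L * Lᵀ + diagonal ψ))

theorem apply_le_norm_mul_transpose_add_diagonal (L : Matrix n (Fin r) ℝ) (ψ : n → ℝ) (i : n) :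
    ψ i ≤ ‖L * Lᵀ + diagonal ψ‖ := by
  calc ψ i ≤ (L * Lᵀ + diagonal ψ) i i := by
        simpa [mul_apply] using Finset.sum_nonneg fun l _ => mul_self_nonneg (L i l)
    _ ≤ ‖L * Lᵀ + diagonal ψ‖ := (le_abs_self _).trans
        (norm_entry_le_entrywise_sup_norm (L * Lᵀ + diagonal ψ))

theorem exists_isMinOn_gaussianLoss {S : Matrix n n ℝ} {Λ : Matrix n (Fin r) ℝ} {s : n → ℝ}
    (hs : ∀ i, 0 < s i) {c : n → ℝ} (hc : ∀ i, 0 < c i) {R : ℝ}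
    (hsub : ∀ (L : Matrix n (Fin r) ℝ) (ψ : n → ℝ), (∀ i, 0 < ψ i) →
      gaussianLoss S (L * Lᵀ + diagonal ψ) ≤ gaussianLoss S (Λ * Λᵀ + diagonal s) →
      c ≤ ψ ∧ ‖L * Lᵀ + diagonal ψ‖ ≤ R) :
    ∃ (L : Matrix n (Fin r) ℝ) (ψ : n → ℝ), (∀ i, 0 < ψ i) ∧
      ∀ (L' : Matrix n (Fin r) ℝ) (ψ' : n → ℝ), (∀ i, 0 < ψ' i) →
        gaussianLoss S (L * Lᵀ + diagonal ψ) ≤ gaussianLoss S (L' * L'ᵀ + diagonal ψ') := by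
  let K : Set (Matrix n (Fin r) ℝ × (n → ℝ)) := Metric.closedBall 0 √R ×ˢ Set.Icc c (fun _ => R)
  have hK : IsCompact K :=
    (ProperSpace.isCompact_closedBall (α := n → Fin r → ℝ) 0 √R).prod isCompact_Icc
  have hmem : ∀ (L : Matrix n (Fin r) ℝ) (ψ : n → ℝ), (∀ i, 0 < ψ i) →
      gaussianLoss S (L * Lᵀ + diagonal ψ) ≤ gaussianLoss S (Λ * Λᵀ + diagonal s) →
      (L, ψ) ∈ K := fun L ψ hψ hle => by
    obtain ⟨hcψ, hR⟩ := hsub L ψ hψ hle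
    refine ⟨mem_closedBall_zero_iff.mpr (Real.le_sqrt_of_sq_le ?_), hcψ, fun i => ?_⟩
    · exact (norm_sq_le_norm_mul_transpose_add_diagonal L fun i => (hψ i).le).trans hR
    · exact (apply_le_norm_mul_transpose_add_diagonal L ψ i).trans hR
  have hpos : ∀ p ∈ K, ∀ i, 0 < p.2 i := fun p hp i => (hc i).trans_le (hp.2.1 i)
  have hcov : Continuous fun p : Matrix n (Fin r) ℝ × (n → ℝ) => p.1 * p.1ᵀ + diagonal p.2 := by
    fun_prop
  obtain ⟨p, hpK, hp⟩ := hK.exists_isMinOn ⟨_, hmem Λ s hs le_rfl⟩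
    (f := fun p => gaussianLoss S (p.1 * p.1ᵀ + diagonal p.2)) fun p hpK =>
      (ContinuousAt.comp (f := fun p : Matrix n (Fin r) ℝ × (n → ℝ) => p.1 * p.1ᵀ + diagonal p.2)
        (continuousAt_gaussianLoss S
          (posDef_mul_transpose_add_diagonal p.1 (hpos p hpK)).det_pos.ne')
        hcov.continuousAt).continuousWithinAt
  refine ⟨p.1, p.2, hpos p hpK, fun L' ψ' hψ' => ?_⟩
  rcases le_or_gt (gaussianLoss S (L' * L'ᵀ + diagonal ψ'))
    (gaussianLoss S (Λ * Λᵀ + diagonal s)) with hle | hgt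
  · exact hp (hmem L' ψ' hψ' hle)
  · exact (hp (hmem Λ s hs le_rfl)).trans hgt.le

theorem exists_unitary_isDiag_transpose_mul_mul (L : Matrix n (Fin r) ℝ) (ψ : n → ℝ) :
    ∃ U ∈ unitaryGroup (Fin r) ℝ, ((L * U)ᵀ * (diagonal ψ)⁻¹ * (L * U)).IsDiag := by
  have hW : (Lᵀ * (diagonal ψ)⁻¹ * L).IsHermitian := by
    simp [IsHermitian, conjTranspose_eq_transpose_of_trivial, transpose_nonsing_inv,
      Matrix.mul_assoc]
  refine ⟨hW.eigenvectorUnitary, hW.eigenvectorUnitary.2, ?_⟩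
  have hdiag : (L * (hW.eigenvectorUnitary : Matrix (Fin r) (Fin r) ℝ))ᵀ * (diagonal ψ)⁻¹ *
      (L * (hW.eigenvectorUnitary : Matrix (Fin r) (Fin r) ℝ)) = diagonal hW.eigenvalues := by
    simpa [star_eq_conjTranspose, conjTranspose_eq_transpose_of_trivial, Matrix.mul_assoc,
      Unitary.conjStarAlgAut_star_apply] using hW.conjStarAlgAut_star_eigenvectorUnitary
  rw [hdiag]
  exact isDiag_diagonal _

theorem exists_isFactorMLE_of_forall_le {N : ℕ} {S : Matrix (Fin N) (Fin N) ℝ}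
    {L : Matrix (Fin N) (Fin r) ℝ} {ψ : Fin N → ℝ} (hψ : ∀ i, 0 < ψ i)
    (hmin : ∀ (L' : Matrix (Fin N) (Fin r) ℝ) (ψ' : Fin N → ℝ), (∀ i, 0 < ψ' i) →
      factorObjective S L ψ ≤ factorObjective S L' ψ') :
    ∃ (L : Matrix (Fin N) (Fin r) ℝ) (ψ : Fin N → ℝ), IsFactorMLE S L ψ := by
  obtain ⟨U, hU, hdiag⟩ := exists_unitary_isDiag_transpose_mul_mul L ψ
  have hrotate : (L * U) * (L * U)ᵀ = L * Lᵀ := by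
    have hUU : U * Uᵀ = 1 := mem_unitaryGroup_iff.mp hU
    rw [transpose_mul, Matrix.mul_assoc, ← Matrix.mul_assoc U, hUU, Matrix.one_mul]
  refine ⟨L * U, ψ, hψ, hdiag, fun L' ψ' hψ' => ?_⟩
  rw [factorObjective, hrotate]
  exact hmin L' ψ' hψ'

variable {Λ : Matrix n (Fin r) ℝ} {s : n → ℝ}

theorem AndersonRubinCondition.exists_sublevel_bound (hΛ : AndersonRubinCondition Λ)
    (hs : ∀ i, 0 < s i) :
    ∃ C ε₀ : ℝ, 0 ≤ C ∧ 0 < ε₀ ∧ ∀ (S : Matrix n n ℝ) (L : Matrix n (Fin r) ℝ) (ψ : n → ℝ),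
      (∀ i, 0 < ψ i) → ‖S - (Λ * Λᵀ + diagonal s)‖ ≤ ε₀ →
      gaussianLoss S (L * Lᵀ + diagonal ψ) ≤ gaussianLoss S (Λ * Λᵀ + diagonal s) →
      ‖L * Lᵀ + diagonal ψ - (Λ * Λᵀ + diagonal s)‖ ≤ C * ‖S - (Λ * Λᵀ + diagonal s)‖ ∧
      ‖ψ - s‖ ≤ C * ‖S - (Λ * Λᵀ + diagonal s)‖ ∧
      ∃ Q : Matrix (Fin r) (Fin r) ℝ, IsUnit Q.det ∧
        ‖L * Q - Λ‖ ≤ C * ‖S - (Λ * Λᵀ + diagonal s)‖ := by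
  set V := Λ * Λᵀ + diagonal s
  obtain ⟨C₁, ε₁, hC₁, hε₁, hcov⟩ :=
    exists_norm_sub_le_of_gaussianLoss_le (posDef_mul_transpose_add_diagonal Λ hs)
  obtain ⟨C₂, hC₂, hvar⟩ := hΛ.eventually_norm_unique_variance_sub_le s
  obtain ⟨C₃, hC₃, hload⟩ := hΛ.eventually_exists_norm_loadings_sub_le s
  obtain ⟨δ, hδ, hball⟩ := Metric.eventually_nhds_iff.mp (hvar.and hload)
  refine ⟨C₁ + C₂ * C₁ + C₃ * C₁, min ε₁ (δ / (C₁ + 1)), by positivity, by positivity,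
    fun S L ψ hψ hS hle => ?_⟩
  have hM := hcov _ S (posDef_mul_transpose_add_diagonal L hψ) (hS.trans (min_le_left _ _)) hle
  have hMδ : ‖L * Lᵀ + diagonal ψ - V‖ < δ := by
    have hSδ := hS.trans (min_le_right _ _)
    rw [le_div_iff₀ (by positivity)] at hSδ
    rcases (norm_nonneg (S - V)).eq_or_lt with h0 | h0
    · rw [← h0, mul_zero] at hM
      exact hM.trans_lt hδ
    · linarith
  have hscale : ∀ {C x : ℝ}, 0 ≤ C → x ≤ C * ‖L * Lᵀ + diagonal ψ - V‖ →
      x ≤ C * C₁ * ‖S - V‖ := fun hC hx =>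
    hx.trans ((mul_le_mul_of_nonneg_left hM hC).trans_eq (mul_assoc _ _ _).symm)
  have h₁ : 0 ≤ C₁ * ‖S - V‖ := by positivity
  have h₂ : 0 ≤ C₂ * C₁ * ‖S - V‖ := by positivity
  have h₃ : 0 ≤ C₃ * C₁ * ‖S - V‖ := by positivity
  obtain ⟨hψs, hLs⟩ := hball (y := L * Lᵀ + diagonal ψ) (by rwa [dist_eq_norm])
  obtain ⟨Q, hQ, hLQ⟩ := hLs L ψ rfl
  exact ⟨by linarith, by linarith [hscale hC₂ (hψs L ψ rfl)], Q, hQ,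
    by linarith [hscale hC₃ hLQ]⟩

theorem exists_pos_forall_le {ι : Type*} [Finite ι] {s : ι → ℝ} (hs : ∀ i, 0 < s i) :
    ∃ m : ℝ, 0 < m ∧ ∀ i, m ≤ s i := by
  rcases isEmpty_or_nonempty ι with _ | _
  · exact ⟨1, one_pos, isEmptyElim⟩
  · obtain ⟨i, hi⟩ := Finite.exists_min s
    exact ⟨s i, hs i, hi⟩

theorem AndersonRubinCondition.exists_mle_bound {N : ℕ} {Λ : Matrix (Fin N) (Fin r) ℝ}
    (hΛ : AndersonRubinCondition Λ) {s : Fin N → ℝ} (hs : ∀ i, 0 < s i) :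
    ∃ C ε₀ : ℝ, 0 ≤ C ∧ 0 < ε₀ ∧ ∀ S : Matrix (Fin N) (Fin N) ℝ,
      ‖S - (Λ * Λᵀ + diagonal s)‖ ≤ ε₀ →
      (∃ (L : Matrix (Fin N) (Fin r) ℝ) (ψ : Fin N → ℝ), IsFactorMLE S L ψ) ∧
      ∀ (L : Matrix (Fin N) (Fin r) ℝ) (ψ : Fin N → ℝ), IsFactorMLE S L ψ →
        ∃ Q : Matrix (Fin r) (Fin r) ℝ, IsUnit Q.det ∧
          ‖L * Q - Λ‖ ≤ C * ‖S - (Λ * Λᵀ + diagonal s)‖ := by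
  set V := Λ * Λᵀ + diagonal s
  obtain ⟨C, ε₁, hC, hε₁, hbound⟩ := hΛ.exists_sublevel_bound hs
  obtain ⟨m, hm, hms⟩ := exists_pos_forall_le hs
  refine ⟨C, min ε₁ (min (m / 2) 1 / (C + 1)), hC, by positivity, fun S hS => ⟨?_, ?_⟩⟩
  · have hCS : C * ‖S - V‖ ≤ min (m / 2) 1 := by
      have h := hS.trans (min_le_right _ _)
      rw [le_div_iff₀ (by positivity)] at h
      linarith [norm_nonneg (S - V)]
    obtain ⟨L, ψ, hψ, hmin⟩ := exists_isMinOn_gaussianLoss (R := ‖V‖ + 1) hs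
      (fun i => half_pos (hs i)) fun L ψ hψ hle => by
        obtain ⟨hM, hψs, -⟩ := hbound S L ψ hψ (hS.trans (min_le_left _ _)) hle
        refine ⟨fun i => ?_, ?_⟩
        · have hi := (norm_le_pi_norm (ψ - s) i).trans (hψs.trans (hCS.trans (min_le_left _ _)))
          linarith [hms i, (abs_le.mp hi).1, Pi.sub_apply ψ s i]
        · linarith [hM.trans (hCS.trans (min_le_right _ _)),
            norm_le_norm_add_norm_sub V (L * Lᵀ + diagonal ψ),
            norm_sub_rev V (L * Lᵀ + diagonal ψ)]
    exact exists_isFactorMLE_of_forall_le hψ hmin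
  · exact fun L ψ hL =>
      (hbound S L ψ hL.1 (hS.trans (min_le_left _ _)) (hL.2.2 Λ s hs)).2.2

end MaximumLikelihood

section TrimmedRegression

open Matrix

attribute [local instance] Matrix.normedAddCommGroup Matrix.normedSpace

theorem sort_apply_le {N : ℕ} {u : Fin N → ℝ} {T : Finset (Fin N)} {b : ℝ}
    (hT : ∀ i ∈ T, u i ≤ b) {j : Fin N} (hj : j.val < T.card) : u (Tuple.sort u j) ≤ b := by
  refine (Tuple.lt_card_le_iff_apply_le_of_monotone (Tuple.monotone_sort u)).mp
    (hj.trans_le ?_)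
  rw [← Finset.card_map (Tuple.sort u).symm.toEmbedding]
  refine Finset.card_le_card fun i hi => ?_
  obtain ⟨k, hk, rfl⟩ := Finset.mem_map.mp hi
  simpa using hT k hk

variable {N r : ℕ} {L : Matrix (Fin N) (Fin r) ℝ} {y : Fin N → ℝ} {a : Fin r → ℝ}
  {T : Finset (Fin N)} {b : ℝ}

theorem ltsObjective_le (hT : N / 2 + 1 ≤ T.card)
    (hb : ∀ i ∈ T, |y i - L.row i ⬝ᵥ a| ≤ b) : ltsObjective L y a ≤ (N / 2 + 1 : ℕ) * b ^ 2 := by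
  calc ltsObjective L y a ≤ ∑ i : Fin N with i.val < N / 2 + 1, b ^ 2 := by
        refine Finset.sum_le_sum fun i hi => ?_
        refine sort_apply_le (u := fun i => (y i - L.row i ⬝ᵥ a) ^ 2) (fun k hk => ?_)
          ((Finset.mem_filter.mp hi).2.trans_le hT)
        exact sq_le_sq' (abs_le.mp (hb k hk)).1 (abs_le.mp (hb k hk)).2
    _ = (Finset.univ.filter fun i : Fin N => i.val < N / 2 + 1).card * b ^ 2 := by
        rw [Finset.sum_const, nsmul_eq_mul]
    _ ≤ (N / 2 + 1 : ℕ) * b ^ 2 := by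
        rw [Fin.card_filter_val_lt]
        gcongr
        exact min_le_right _ _

theorem exists_card_of_ltsObjective_le (hN : N / 2 + 1 ≤ N) (hb0 : 0 ≤ b)
    (hb : ltsObjective L y a ≤ b ^ 2) :
    ∃ H : Finset (Fin N), H.card = N / 2 + 1 ∧ ∀ i ∈ H, |y i - L.row i ⬝ᵥ a| ≤ b := by
  set u : Fin N → ℝ := fun i => (y i - L.row i ⬝ᵥ a) ^ 2
  refine ⟨(Finset.univ.filter fun i : Fin N => i.val < N / 2 + 1).map
    (Tuple.sort u).toEmbedding, ?_, fun i hi => ?_⟩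
  · rw [Finset.card_map, Fin.card_filter_val_lt]
    exact min_eq_right hN
  · obtain ⟨k, hk, rfl⟩ := Finset.mem_map.mp hi
    have hterm : u (Tuple.sort u k) ≤ ltsObjective L y a :=
      Finset.single_le_sum (f := fun k => u (Tuple.sort u k)) (fun j _ => sq_nonneg _) hk
    exact abs_le_of_sq_le_sq (hterm.trans hb) hb0

/- More than half of the residuals at a minimizer are as small as those of any competitor on `T`;
counting shows that many of them belong to `T` itself. -/
theorem IsLTS.exists_subset_abs_residual_le (ha : IsLTS L y a)
    (hT : N / 2 + 1 ≤ T.card) {a' : Fin r → ℝ} (hb0 : 0 ≤ b)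
    (hb : ∀ i ∈ T, |y i - L.row i ⬝ᵥ a'| ≤ b) :
    ∃ S ⊆ T, T.card + N / 2 + 1 ≤ N + S.card ∧
      ∀ i ∈ S, |y i - L.row i ⬝ᵥ a| ≤ (N + 1) * b := by
  have hN : N / 2 + 1 ≤ N := hT.trans ((Finset.card_le_univ T).trans_eq (Fintype.card_fin N))
  have hobj : ltsObjective L y a ≤ ((N + 1) * b) ^ 2 :=
    calc ltsObjective L y a ≤ (N / 2 + 1 : ℕ) * b ^ 2 := (ha a').trans (ltsObjective_le hT hb)
      _ ≤ ((N + 1 : ℕ) : ℝ) ^ 2 * b ^ 2 := by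
          gcongr
          exact_mod_cast (by omega : N / 2 + 1 ≤ N + 1).trans (Nat.le_self_pow two_ne_zero _)
      _ = ((N + 1) * b) ^ 2 := by push_cast; ring
  obtain ⟨H, hHcard, hH⟩ := exists_card_of_ltsObjective_le hN (by positivity) hobj
  refine ⟨H ∩ T, Finset.inter_subset_right, ?_, fun i hi => hH i (Finset.mem_inter.mp hi).1⟩
  have hunion := (Finset.card_le_univ (H ∪ T)).trans_eq (Fintype.card_fin N)
  have := Finset.card_union_add_card_inter H T
  omega

theorem mulVec_mul_mulVec_inv {Q : Matrix (Fin r) (Fin r) ℝ} (hQ : IsUnit Q.det)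
    (L : Matrix (Fin N) (Fin r) ℝ) (a : Fin r → ℝ) : (L * Q) *ᵥ (Q⁻¹ *ᵥ a) = L *ᵥ a := by
  rw [mulVec_mulVec, Matrix.mul_assoc, mul_nonsing_inv _ hQ, Matrix.mul_one]

theorem IsLTS.mul_right (ha : IsLTS L y a) {Q : Matrix (Fin r) (Fin r) ℝ} (hQ : IsUnit Q.det) :
    IsLTS (L * Q) y (Q⁻¹ *ᵥ a) := by
  have hobj : ∀ {L' : Matrix (Fin N) (Fin r) ℝ} {a₁ a₂ : Fin r → ℝ}, L' *ᵥ a₁ = L *ᵥ a₂ →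
      ltsObjective L' y a₁ = ltsObjective L y a₂ := fun {L' a₁ a₂} h => by
    have hrow : ∀ i, L'.row i ⬝ᵥ a₁ = L.row i ⬝ᵥ a₂ := congrFun h
    simp only [ltsObjective, hrow]
  intro x
  rw [hobj (mulVec_mul_mulVec_inv hQ L a), hobj (mulVec_mulVec x L Q).symm]
  exact ha _

theorem betaHat_mul_right {Q : Matrix (Fin r) (Fin r) ℝ} (hQ : IsUnit Q.det)
    (L : Matrix (Fin N) (Fin r) ℝ) (y : Fin N → ℝ) (a : Fin r → ℝ) :
    betaHat (L * Q) y (Q⁻¹ *ᵥ a) = betaHat L y a := by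
  rw [betaHat, betaHat, mulVec_mul_mulVec_inv hQ]

theorem abs_row_dotProduct_le {n : Type*} [Fintype n] (L : Matrix n (Fin r) ℝ) (i : n)
    (x : Fin r → ℝ) : |L.row i ⬝ᵥ x| ≤ r * ‖L‖ * ‖x‖ := by
  calc |L.row i ⬝ᵥ x| ≤ ∑ k, |L i k * x k| := Finset.abs_sum_le_sum_abs _ _
    _ ≤ ∑ _k : Fin r, ‖L‖ * ‖x‖ := by
        gcongr with k
        rw [abs_mul]
        exact mul_le_mul L.norm_entry_le_entrywise_sup_norm (norm_le_pi_norm x k)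
          (abs_nonneg _) (norm_nonneg _)
    _ = r * ‖L‖ * ‖x‖ := by simp [mul_assoc]

theorem exists_norm_le_of_span_eq_top {n : Type*} {Λ : Matrix n (Fin r) ℝ}
    {S : Finset n} (hS : Submodule.span ℝ (Λ.row '' (S : Set n)) = ⊤) :
    ∃ κ : ℝ, 0 ≤ κ ∧ ∀ (x : Fin r → ℝ) (b : ℝ), 0 ≤ b → (∀ i ∈ S, |Λ.row i ⬝ᵥ x| ≤ b) →
      ‖x‖ ≤ κ * b := by
  let f : (Fin r → ℝ) →ₗ[ℝ] (S → ℝ) := (Λ.submatrix (Subtype.val : S → n) id).mulVecLin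
  have hker : LinearMap.ker f = ⊥ := by
    refine LinearMap.ker_eq_bot'.mpr fun x hx => ?_
    have hspan : Submodule.span ℝ (Λ.row '' (S : Set n)) ≤
        LinearMap.ker ((dotProductBilin ℝ ℝ).flip x) := by
      rw [Submodule.span_le]
      rintro - ⟨i, hi, rfl⟩
      exact congrFun hx ⟨i, hi⟩
    exact dotProduct_self_eq_zero.mp (hspan (hS ▸ Submodule.mem_top : x ∈ _))
  obtain ⟨κ, -, hκ⟩ := f.exists_antilipschitzWith hker
  refine ⟨κ, κ.2, fun x b hb hx => ?_⟩
  calc ‖x‖ ≤ κ * ‖f x‖ := by simpa using hκ.le_mul_dist x 0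
    _ ≤ κ * b := by
        gcongr
        exact (pi_norm_le_iff_of_nonneg hb).mpr fun i => hx i i.2

theorem exists_norm_le_of_norm_sub_le {n : Type*} [Fintype n] (Λ : Matrix n (Fin r) ℝ) :
    ∃ κ ε₀ : ℝ, 0 ≤ κ ∧ 0 < ε₀ ∧ ∀ L : Matrix n (Fin r) ℝ, ‖L - Λ‖ ≤ ε₀ →
      ∀ S : Finset n, Submodule.span ℝ (Λ.row '' (S : Set n)) = ⊤ →
      ∀ (x : Fin r → ℝ) (b : ℝ), 0 ≤ b → (∀ i ∈ S, |L.row i ⬝ᵥ x| ≤ b) → ‖x‖ ≤ κ * b := by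
  have hspan : ∀ S : Finset n, ∃ κ : ℝ, 0 ≤ κ ∧
      (Submodule.span ℝ (Λ.row '' (S : Set n)) = ⊤ → ∀ (x : Fin r → ℝ) (b : ℝ), 0 ≤ b →
        (∀ i ∈ S, |Λ.row i ⬝ᵥ x| ≤ b) → ‖x‖ ≤ κ * b) := fun S => by
    by_cases hS : Submodule.span ℝ (Λ.row '' (S : Set n)) = ⊤
    · obtain ⟨κ, hκ, h⟩ := exists_norm_le_of_span_eq_top hS
      exact ⟨κ, hκ, fun _ => h⟩
    · exact ⟨0, le_rfl, fun h => absurd h hS⟩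
  choose κ hκ0 hκ using hspan
  have hκsum : 0 ≤ ∑ S, κ S := Finset.sum_nonneg fun S _ => hκ0 S
  refine ⟨2 * ∑ S, κ S, 1 / (2 * (∑ S, κ S) * r + 1), by positivity, by positivity,
    fun L hL S hS x b hb hx => ?_⟩
  have hΛx : ∀ i ∈ S, |Λ.row i ⬝ᵥ x| ≤ b + r * ‖L - Λ‖ * ‖x‖ := fun i hi => by
    have hsplit : Λ.row i ⬝ᵥ x = L.row i ⬝ᵥ x - (L - Λ).row i ⬝ᵥ x := by
      rw [← sub_dotProduct]
      congr 1
      ext k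
      simp
    rw [hsplit]
    exact (abs_sub _ _).trans (add_le_add (hx i hi) (abs_row_dotProduct_le _ i x))
  have hx' : ‖x‖ ≤ (∑ S, κ S) * (b + r * ‖L - Λ‖ * ‖x‖) :=
    (hκ S hS x _ (by positivity) hΛx).trans (mul_le_mul_of_nonneg_right
      (Finset.single_le_sum (fun S _ => hκ0 S) (Finset.mem_univ S)) (by positivity))
  have habsorb : (∑ S, κ S) * (r * ‖L - Λ‖) ≤ 1 / 2 := by
    have := hL
    rw [le_div_iff₀ (by positivity)] at this
    nlinarith [norm_nonneg (L - Λ)]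
  nlinarith [mul_le_mul_of_nonneg_right habsorb (norm_nonneg x)]

theorem abs_residual_le {n : Type*} [Fintype n] {L Λ : Matrix n (Fin r) ℝ} {y β : n → ℝ}
    {α : Fin r → ℝ} {ε K : ℝ} (hL : ‖L - Λ‖ ≤ ε) (hy : ‖y - (β + Λ *ᵥ α)‖ ≤ ε) (hα : ‖α‖ ≤ K)
    (i : n) : |y i - β i - L.row i ⬝ᵥ α| ≤ (1 + r * K) * ε := by
  have hε : 0 ≤ ε := (norm_nonneg _).trans hL
  have hsplit : y i - β i - L.row i ⬝ᵥ α = (y - (β + Λ *ᵥ α)) i - (L - Λ).row i ⬝ᵥ α := by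
    have hrow : (L - Λ).row i ⬝ᵥ α = L.row i ⬝ᵥ α - Λ.row i ⬝ᵥ α := sub_dotProduct _ _ _
    rw [hrow]
    simp only [Pi.sub_apply, Pi.add_apply, mulVec, row_def]
    ring
  calc |y i - β i - L.row i ⬝ᵥ α|
      ≤ ‖y - (β + Λ *ᵥ α)‖ + r * ‖L - Λ‖ * ‖α‖ := hsplit ▸ (abs_sub _ _).trans
        (add_le_add (norm_le_pi_norm (y - (β + Λ *ᵥ α)) i) (abs_row_dotProduct_le _ i α))
    _ ≤ ε + r * ε * K := by gcongr
    _ = (1 + r * K) * ε := by ring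

/- The minimizer competes with the true coefficient `α`, whose residuals on `T` are small; on the
rows where both fits are accurate the loadings span, so `a` is close to `α`. -/
theorem exists_lts_bound (Λ : Matrix (Fin N) (Fin r) ℝ) (K : ℝ) :
    ∃ C ε₀ : ℝ, 0 ≤ C ∧ 0 < ε₀ ∧ ∀ (L : Matrix (Fin N) (Fin r) ℝ) (y β : Fin N → ℝ)
      (a α : Fin r → ℝ) (ε : ℝ) (T : Finset (Fin N)), ε ≤ ε₀ → ‖α‖ ≤ K → (∀ i ∈ T, β i = 0) →
      N / 2 + 1 ≤ T.card →
      (∀ S ⊆ T, T.card + N / 2 + 1 ≤ N + S.card →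
        Submodule.span ℝ (Λ.row '' (S : Set (Fin N))) = ⊤) →
      ‖L - Λ‖ ≤ ε → ‖y - (β + Λ *ᵥ α)‖ ≤ ε → IsLTS L y a → ‖betaHat L y a - β‖ ≤ C * ε := by
  obtain ⟨κ, ε₀, hκ, hε₀, hspan⟩ := exists_norm_le_of_norm_sub_le Λ
  set B : ℝ := 1 + r * |K|
  have : 0 ≤ B := by positivity
  refine ⟨B + r * (‖Λ‖ + ε₀) * (κ * ((N + 2) * B)), ε₀, by positivity, hε₀,
    fun L y β a α ε T hε hα hβ hT hgp hL hy ha => ?_⟩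
  have hε0 : 0 ≤ ε := (norm_nonneg _).trans hL
  have hfit : ∀ i, |y i - β i - L.row i ⬝ᵥ α| ≤ B * ε :=
    abs_residual_le hL hy (hα.trans (le_abs_self K))
  obtain ⟨S, hST, hcard, hS⟩ := ha.exists_subset_abs_residual_le hT (a' := α)
    (by positivity : 0 ≤ B * ε) fun i hi => by simpa [hβ i hi] using hfit i
  have hclose : ‖α - a‖ ≤ κ * ((N + 2) * B * ε) := by
    refine hspan L (hL.trans hε) S (hgp S hST hcard) _ _ (by positivity) fun i hi => ?_
    have hα' := hfit i
    rw [hβ i (hST hi), sub_zero, abs_le] at hα'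
    have ha' := abs_le.mp (hS i hi)
    rw [dotProduct_sub, abs_le]
    constructor <;> linarith
  refine (pi_norm_le_iff_of_nonneg (by positivity)).mpr fun i => ?_
  have hsplit : (betaHat L y a - β) i = (y i - β i - L.row i ⬝ᵥ α) + L.row i ⬝ᵥ (α - a) := by
    simp only [betaHat, mulVec, row_def, Pi.sub_apply, dotProduct_sub]
    ring
  have hLΛ : ‖L‖ ≤ ‖Λ‖ + ε₀ := by
    linarith [norm_le_norm_add_norm_sub Λ L, norm_sub_rev Λ L]
  calc ‖(betaHat L y a - β) i‖ ≤ B * ε + r * ‖L‖ * ‖α - a‖ := hsplit ▸ (abs_add_le _ _).trans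
        (add_le_add (hfit i) (abs_row_dotProduct_le L i _))
    _ ≤ B * ε + r * (‖Λ‖ + ε₀) * (κ * ((N + 2) * B * ε)) := by gcongr
    _ = (B + r * (‖Λ‖ + ε₀) * (κ * ((N + 2) * B))) * ε := by ring

end TrimmedRegression

section NoiseLevel

open Matrix

attribute [local instance] Matrix.normedAddCommGroup Matrix.normedSpace

variable {n : Type*} [Fintype n] [DecidableEq n]

theorem abs_eigenvalues_le {S : Matrix n n ℝ} (hS : S.IsHermitian) (k : n) :
    |hS.eigenvalues k| ≤ (Fintype.card n : ℝ) ^ 2 * ‖S‖ := by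
  have hdiag : hS.eigenvalues k =
      Unitary.conjStarAlgAut ℝ _ (star hS.eigenvectorUnitary) S k k := by
    rw [hS.conjStarAlgAut_star_eigenvectorUnitary]
    simp
  rw [hdiag]
  exact (norm_entry_le_entrywise_sup_norm _).trans (norm_conjStarAlgAut_le _ S)

theorem sub_le_eigenvalues {S V : Matrix n n ℝ} (hS : S.IsHermitian) {m : ℝ}
    (hV : (V - m • 1).PosSemidef) (k : n) :
    m - (Fintype.card n : ℝ) ^ 2 * ‖S - V‖ ≤ hS.eigenvalues k := by
  set c := Unitary.conjStarAlgAut ℝ (Matrix n n ℝ) (star hS.eigenvectorUnitary) with hc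
  have hdiag : hS.eigenvalues k = c (V - m • 1) k k + m + c (S - V) k k := by
    have h : c S k k = c (V - m • 1) k k + m + c (S - V) k k := by
      simp only [map_sub, map_smul, map_one]
      simp
    rw [← h, hc, hS.conjStarAlgAut_star_eigenvectorUnitary]
    simp
  have hpos : 0 ≤ c (V - m • 1) k k := by
    have : (c (V - m • 1)).PosSemidef := by
      rw [hc, Unitary.conjStarAlgAut_apply]
      exact hV.mul_mul_conjTranspose_same _
    exact this.diag_nonneg
  have hpert : |c (S - V) k k| ≤ (Fintype.card n : ℝ) ^ 2 * ‖S - V‖ :=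
    (norm_entry_le_entrywise_sup_norm _).trans (norm_conjStarAlgAut_le _ _)
  linarith [(abs_le.mp hpert).1]

variable {Ω : Type*} {N r : ℕ}

theorem Panel.sigmaHat_mem_Icc (hN : 0 < N) {P : Panel Ω N r} {T : ℕ} {ω : Ω} {a b : ℝ}
    (ha : 0 ≤ a) (hab : ∀ k, (P.preCov_isHermitian T ω).eigenvalues k ∈ Set.Icc a b) :
    P.sigmaHat T ω ∈ Set.Icc √((N : ℝ)⁻¹ * a) √b := by
  set ν := (P.preCov_isHermitian T ω).eigenvalues₀
  have hν : ∀ j, ν j ∈ Set.Icc a b := fun j => by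
    simpa [Matrix.IsHermitian.eigenvalues] using
      hab (Fintype.equivOfCardEq (Fintype.card_fin _) j)
  have hν0 : ∀ j, 0 ≤ ν j := fun j => ha.trans (hν j).1
  have hlast : N - 1 < Fintype.card (Fin N) := by rw [Fintype.card_fin]; omega
  constructor <;> refine Real.sqrt_le_sqrt ?_
  · refine mul_le_mul_of_nonneg_left ((hν ⟨N - 1, hlast⟩).1.trans ?_) (by positivity)
    refine Finset.single_le_sum (f := ν) (fun j _ => hν0 j) ?_
    simp only [Finset.mem_filter, Finset.mem_univ, true_and]
    omega
  · calc (N : ℝ)⁻¹ * ∑ j : Fin (Fintype.card (Fin N)) with (N + 1) / 2 ≤ j.val + 1 + r, ν j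
        ≤ (N : ℝ)⁻¹ * ∑ _j : Fin (Fintype.card (Fin N)), b := by
          gcongr
          exact (Finset.sum_le_univ_sum_of_nonneg hν0).trans
            (Finset.sum_le_sum fun j _ => (hν j).2)
      _ = b := by
          have : (N : ℝ) ≠ 0 := by positivity
          simp [this]

theorem exists_sigmaHat_bounds (hN : 0 < N) (Λ : Matrix (Fin N) (Fin r) ℝ) {s : Fin N → ℝ}
    (hs : ∀ i, 0 < s i) :
    ∃ a b ε₀ : ℝ, 0 < a ∧ 0 < ε₀ ∧ ∀ (P : Panel Ω N r) (T : ℕ) (ω : Ω),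
      ‖P.preCov T ω - (Λ * Λᵀ + diagonal s)‖ ≤ ε₀ → P.sigmaHat T ω ∈ Set.Icc a b := by
  set V := Λ * Λᵀ + diagonal s with hV
  obtain ⟨m, hm, hms⟩ := exists_pos_forall_le hs
  have hVm : (V - m • 1).PosSemidef := by
    have : V - m • 1 = Λ * Λᴴ + diagonal fun i => s i - m := by
      rw [hV, smul_one_eq_diagonal, ← diagonal_sub, conjTranspose_eq_transpose_of_trivial]
      abel
    rw [this]
    exact (posSemidef_self_mul_conjTranspose Λ).add
      (PosSemidef.diagonal fun i => sub_nonneg.mpr (hms i))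
  refine ⟨√((N : ℝ)⁻¹ * (m / 2)), √((N : ℝ) ^ 2 * (‖V‖ + m)), min m (m / (2 * N ^ 2)),
    by positivity, by positivity, fun P T ω hP => ?_⟩
  refine Panel.sigmaHat_mem_Icc hN (by positivity) fun k => ⟨?_, ?_⟩
  · have hpert := hP.trans (min_le_right _ _)
    rw [le_div_iff₀ (by positivity)] at hpert
    have hlow := sub_le_eigenvalues (P.preCov_isHermitian T ω) hVm k
    rw [Fintype.card_fin] at hlow
    linarith
  · have hup := (le_abs_self _).trans (abs_eigenvalues_le (P.preCov_isHermitian T ω) k)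
    rw [Fintype.card_fin] at hup
    refine hup.trans ?_
    gcongr
    linarith [norm_le_norm_add_norm_sub V (P.preCov T ω), norm_sub_rev V (P.preCov T ω),
      hP.trans (min_le_left _ _)]

end NoiseLevel

section AlphaMixing

variable {Ω E : Type*}

theorem abs_measureReal_inter_sub_mul_le_one [MeasurableSpace Ω] (μ : Measure Ω)
    [IsProbabilityMeasure μ] (A B : Set Ω) :
    |μ.real (A ∩ B) - μ.real A * μ.real B| ≤ 1 :=
  abs_sub_le_of_nonneg_of_le measureReal_nonneg measureReal_le_one (by positivity)
    (mul_le_one₀ measureReal_le_one measureReal_nonneg measureReal_le_one)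

theorem abs_measureReal_inter_sub_mul_le_alphaCoef {m₁ m₂ : MeasurableSpace Ω} [MeasurableSpace Ω]
    (μ : Measure Ω) [IsProbabilityMeasure μ] {A B : Set Ω} (hA : MeasurableSet[m₁] A)
    (hB : MeasurableSet[m₂] B) :
    |μ.real (A ∩ B) - μ.real A * μ.real B| ≤ alphaCoef μ m₁ m₂ := by
  refine le_csSup ⟨1, ?_⟩ ⟨A, B, hA, hB, rfl⟩
  rintro _ ⟨A, B, -, -, rfl⟩
  exact abs_measureReal_inter_sub_mul_le_one μ A B

theorem alphaCoef_le_one (m₁ m₂ : MeasurableSpace Ω) [MeasurableSpace Ω] (μ : Measure Ω)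
    [IsProbabilityMeasure μ] : alphaCoef μ m₁ m₂ ≤ 1 := by
  refine Real.sSup_le ?_ zero_le_one
  rintro _ ⟨A, B, -, -, rfl⟩
  exact abs_measureReal_inter_sub_mul_le_one μ A B

theorem alphaCoef_nonneg (m₁ m₂ : MeasurableSpace Ω) [MeasurableSpace Ω] (μ : Measure Ω) :
    0 ≤ alphaCoef μ m₁ m₂ := by
  refine Real.sSup_nonneg ?_
  rintro _ ⟨A, B, -, -, rfl⟩
  exact abs_nonneg _

theorem alphaCoef_le_mixingCoef [MeasurableSpace Ω] [MeasurableSpace E] (μ : Measure Ω)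
    [IsProbabilityMeasure μ] (Z : ℕ → ℕ → Ω → E) (T s k : ℕ) :
    alphaCoef μ (sigmaBlock (Z T) 1 s) (sigmaBlock (Z T) (s + k) T) ≤ mixingCoef μ Z k :=
  le_ciSup (f := fun p : ℕ × ℕ =>
    alphaCoef μ (sigmaBlock (Z p.1) 1 p.2) (sigmaBlock (Z p.1) (p.2 + k) p.1))
    ⟨1, by rintro _ ⟨p, rfl⟩; exact alphaCoef_le_one _ _ μ⟩ (T, s)

theorem mixingCoef_nonneg [MeasurableSpace Ω] [MeasurableSpace E] (μ : Measure Ω)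
    (Z : ℕ → ℕ → Ω → E) (k : ℕ) : 0 ≤ mixingCoef μ Z k :=
  Real.iSup_nonneg fun _ => alphaCoef_nonneg _ _ μ

end AlphaMixing

section Truncation

theorem sq_le_rpow_mul_rpow {x a p : ℝ} (ha : 0 < a) (hp : 2 ≤ p) (hx : a ≤ x) :
    x ^ 2 ≤ a ^ (2 - p) * x ^ p := by
  have hx0 : 0 < x := ha.trans_le hx
  calc x ^ 2 = x ^ (2 - p) * x ^ p := by rw [← Real.rpow_add hx0]; norm_num
    _ ≤ a ^ (2 - p) * x ^ p := by
      gcongr ?_ * _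
      exact Real.rpow_le_rpow_of_nonpos ha hx (by linarith)

theorem abs_mul_le_rpow_mul_of_le_max {x y a p : ℝ} (ha : 0 < a) (hp : 2 ≤ p)
    (h : a ≤ max |x| |y|) : |x * y| ≤ a ^ (2 - p) * (|x| ^ p + |y| ^ p) := by
  wlog hxy : |x| ≤ |y| generalizing x y
  · rw [mul_comm x, add_comm]
    exact this (max_comm |x| _ ▸ h) (le_of_not_ge hxy)
  rw [max_eq_right hxy] at h
  calc |x * y| ≤ |y| ^ 2 := by
        rw [abs_mul, sq]
        gcongr
    _ ≤ a ^ (2 - p) * |y| ^ p := sq_le_rpow_mul_rpow ha hp h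
    _ ≤ a ^ (2 - p) * (|x| ^ p + |y| ^ p) := by
      gcongr
      exact le_add_of_nonneg_left (by positivity)

theorem abs_mul_sub_truncation_mul_truncation_le {α : Type*} (f g : α → ℝ) {a p : ℝ} (ha : 0 < a)
    (hp : 2 ≤ p) (x : α) :
    |f x * g x - truncation f a x * truncation g a x| ≤
      a ^ (2 - p) * (|f x| ^ p + |g x| ^ p) := by
  by_cases h : a ≤ max |f x| |g x|
  · refine le_trans ?_ (abs_mul_le_rpow_mul_of_le_max ha hp h)
    simp only [truncation, Function.comp_apply, Set.indicator_apply, id]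
    split_ifs <;> simp [mul_nonneg]
  · obtain ⟨hf, hg⟩ := max_lt_iff.1 (not_le.1 h)
    rw [truncation_eq_self hf, truncation_eq_self hg, sub_self, abs_zero]
    positivity

variable {Ω : Type*} [MeasurableSpace Ω] (μ : Measure Ω) [IsProbabilityMeasure μ] {X Y : Ω → ℝ}

theorem abs_integral_mul_sub_integral_truncation_mul_truncation_le {a p B : ℝ} (ha : 0 < a)
    (hp : 2 ≤ p) (hX : MemLp X (ENNReal.ofReal p) μ) (hY : MemLp Y (ENNReal.ofReal p) μ)
    (hXB : ∫ ω, |X ω| ^ p ∂μ ≤ B) (hYB : ∫ ω, |Y ω| ^ p ∂μ ≤ B) :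
    |∫ ω, X ω * Y ω ∂μ - ∫ ω, truncation X a ω * truncation Y a ω ∂μ| ≤
      2 * B * a ^ (2 - p) := by
  have h2p : (2 : ENNReal) ≤ ENNReal.ofReal p := by simpa using hp
  have hXY : Integrable (fun ω => X ω * Y ω) μ :=
    (hX.mono_exponent h2p).integrable_mul (q := 2) (hY.mono_exponent h2p)
  have htXY : Integrable (fun ω => truncation X a ω * truncation Y a ω) μ :=
    (hX.1.memLp_truncation (p := 2)).integrable_mul (q := 2) hY.1.memLp_truncation
  have hpow : ∀ {Z : Ω → ℝ}, MemLp Z (ENNReal.ofReal p) μ → Integrable (fun ω => |Z ω| ^ p) μ :=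
    fun hZ => by simpa [ENNReal.toReal_ofReal (zero_le_two.trans hp)] using hZ.integrable_norm_rpow'
  calc |∫ ω, X ω * Y ω ∂μ - ∫ ω, truncation X a ω * truncation Y a ω ∂μ|
      ≤ ∫ ω, |X ω * Y ω - truncation X a ω * truncation Y a ω| ∂μ := by
        rw [← integral_sub hXY htXY]
        exact abs_integral_le_integral_abs
    _ ≤ ∫ ω, a ^ (2 - p) * (|X ω| ^ p + |Y ω| ^ p) ∂μ :=
        integral_mono (hXY.sub htXY).abs (((hpow hX).add (hpow hY)).const_mul _)
          fun ω => abs_mul_sub_truncation_mul_truncation_le X Y ha hp ω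
    _ = a ^ (2 - p) * (∫ ω, |X ω| ^ p ∂μ + ∫ ω, |Y ω| ^ p ∂μ) := by
        rw [integral_const_mul, integral_add (hpow hX) (hpow hY)]
    _ ≤ a ^ (2 - p) * (B + B) := by gcongr
    _ = 2 * B * a ^ (2 - p) := by ring

theorem abs_covariance_sub_covariance_truncation_le {a p B : ℝ} (ha : 0 < a) (hp : 2 ≤ p)
    (hX : MemLp X (ENNReal.ofReal p) μ) (hY : MemLp Y (ENNReal.ofReal p) μ)
    (hXB : ∫ ω, |X ω| ^ p ∂μ ≤ B) (hYB : ∫ ω, |Y ω| ^ p ∂μ ≤ B) :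
    |cov[X, Y; μ] - cov[truncation X a, truncation Y a; μ]| ≤ 4 * B * a ^ (2 - p) := by
  have h2p : (2 : ENNReal) ≤ ENNReal.ofReal p := by simpa using hp
  rw [covariance_eq_sub (hX.mono_exponent h2p) (hY.mono_exponent h2p),
    covariance_eq_sub hX.1.memLp_truncation hY.1.memLp_truncation]
  have hdiag := abs_integral_mul_sub_integral_truncation_mul_truncation_le μ ha hp hX hY hXB hYB
  -- the product of the means is the mean of `X ω₁ * Y ω₂` under `μ.prod μ`
  have hprod := abs_integral_mul_sub_integral_truncation_mul_truncation_le (μ.prod μ) ha hp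
    (hX.comp_fst μ) (hY.comp_snd μ) (B := B)
    (by rwa [integral_fun_fst (fun ω => |X ω| ^ p), probReal_univ, one_smul])
    (by rwa [integral_fun_snd (fun ω => |Y ω| ^ p), probReal_univ, one_smul])
  rw [integral_prod_mul] at hprod
  have htrunc : ∫ z, truncation (fun z : Ω × Ω => X z.1) a z *
      truncation (fun z : Ω × Ω => Y z.2) a z ∂μ.prod μ =
      (∫ ω, truncation X a ω ∂μ) * ∫ ω, truncation Y a ω ∂μ :=
    integral_prod_mul (truncation X a) (truncation Y a)
  rw [htrunc] at hprod
  simp only [Pi.mul_apply]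
  rw [abs_le] at hdiag hprod ⊢
  constructor <;> linarith [hdiag.1, hdiag.2, hprod.1, hprod.2]

end Truncation

section CovarianceInequality

theorem abs_integral_sub_integral_le_of_abs_measureReal_sub_le {Ω : Type*}
    {m m0 : MeasurableSpace Ω} (hm : m ≤ m0) (ν₁ ν₂ : Measure[m0] Ω) [IsFiniteMeasure ν₁]
    [IsFiniteMeasure ν₂] {Y : Ω → ℝ} (hY : Measurable[m] Y) {b ε : ℝ} (hb : 0 ≤ b)
    (hYb : ∀ ω, Y ω ∈ Set.Icc 0 b)
    (h : ∀ A, MeasurableSet[m] A → |ν₁.real A - ν₂.real A| ≤ ε) :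
    |∫ ω, Y ω ∂ν₁ - ∫ ω, Y ω ∂ν₂| ≤ b * ε := by
  have hlayer : ∀ (ν : Measure Ω) [IsFiniteMeasure ν],
      ∫ ω, Y ω ∂ν = ∫ t in Set.Ioc 0 b, ν.real {ω | t ≤ Y ω} := fun ν _ =>
    (Integrable.of_mem_Icc 0 b (hY.mono hm le_rfl).aemeasurable
      (.of_forall hYb)).integral_eq_integral_Ioc_meas_le
      (.of_forall fun ω => (hYb ω).1) (.of_forall fun ω => (hYb ω).2)
  have hinteg : ∀ (ν : Measure Ω) [IsFiniteMeasure ν],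
      IntegrableOn (fun t => ν.real {ω | t ≤ Y ω}) (Set.Ioc 0 b) := by
    intro ν _
    have hanti : Antitone fun t => ν.real {ω | t ≤ Y ω} := fun s t hst =>
      measureReal_mono fun ω hω => hst.trans hω
    exact Integrable.of_mem_Icc 0 (ν.real Set.univ) hanti.measurable.aemeasurable
      (.of_forall fun t => ⟨measureReal_nonneg, measureReal_mono (Set.subset_univ _)⟩)
  rw [hlayer ν₁, hlayer ν₂, ← integral_sub (hinteg ν₁) (hinteg ν₂), ← Real.norm_eq_abs]
  refine (norm_setIntegral_le_of_norm_le_const (C := ε) (by simp) fun t _ =>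
    h _ (measurableSet_le measurable_const hY)).trans_eq ?_
  rw [Real.volume_real_Ioc_of_le hb, sub_zero, mul_comm]

variable {Ω : Type*} {m₁ m₂ m0 : MeasurableSpace Ω} (hm₁ : m₁ ≤ m0) (hm₂ : m₂ ≤ m0)
  (μ : Measure[m0] Ω) [IsProbabilityMeasure μ] {X Y : Ω → ℝ}
include hm₁

theorem abs_setIntegral_sub_mul_integral_le_alphaCoef (hX : Measurable[m₁] X) {a : ℝ} (ha : 0 ≤ a)
    (hXa : ∀ ω, X ω ∈ Set.Icc 0 a) {B : Set Ω} (hB : MeasurableSet[m₂] B) :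
    |∫ ω in B, X ω ∂μ - μ.real B * ∫ ω, X ω ∂μ| ≤ a * alphaCoef μ m₁ m₂ := by
  have : IsFiniteMeasure (μ B • μ) := μ.smul_finite (measure_ne_top μ B)
  have hclose : ∀ A, MeasurableSet[m₁] A →
      |(μ.restrict B).real A - (μ B • μ).real A| ≤ alphaCoef μ m₁ m₂ := fun A hA => by
    rw [measureReal_restrict_apply (hm₁ A hA), measureReal_ennreal_smul_apply, mul_comm]
    exact abs_measureReal_inter_sub_mul_le_alphaCoef μ hA hB
  simpa only [integral_smul_measure] using!
    abs_integral_sub_integral_le_of_abs_measureReal_sub_le hm₁ _ _ hX ha hXa hclose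

include hm₂

theorem abs_covariance_le_alphaCoef_of_mem_Icc (hX : Measurable[m₁] X) (hY : Measurable[m₂] Y)
    {a b : ℝ} (ha : 0 ≤ a) (hb : 0 ≤ b) (hXa : ∀ ω, X ω ∈ Set.Icc 0 a)
    (hYb : ∀ ω, Y ω ∈ Set.Icc 0 b) :
    |cov[X, Y; μ]| ≤ b * (a * alphaCoef μ m₁ m₂) := by
  have hX' : Measurable X := hX.mono hm₁ le_rfl
  have hX2 : MemLp X 2 μ := memLp_of_bounded (.of_forall hXa) hX'.aestronglyMeasurable 2
  have hY2 : MemLp Y 2 μ :=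
    memLp_of_bounded (.of_forall hYb) (hY.mono hm₂ le_rfl).aestronglyMeasurable 2
  have hXi : Integrable X μ := hX2.integrable one_le_two
  have hX0 : ∀ ω, 0 ≤ X ω := fun ω => (hXa ω).1
  have hE0 : 0 ≤ ∫ ω, X ω ∂μ := integral_nonneg hX0
  have : IsFiniteMeasure (μ.withDensity fun ω => ENNReal.ofReal (X ω)) :=
    isFiniteMeasure_withDensity_ofReal hXi.2
  have : IsFiniteMeasure (ENNReal.ofReal (∫ ω, X ω ∂μ) • μ) := μ.smul_finite ENNReal.ofReal_ne_top
  have hclose : ∀ B, MeasurableSet[m₂] B →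
      |(μ.withDensity fun ω => ENNReal.ofReal (X ω)).real B -
        (ENNReal.ofReal (∫ ω, X ω ∂μ) • μ).real B| ≤ a * alphaCoef μ m₁ m₂ := fun B hB => by
    rw [Measure.real, withDensity_apply _ (hm₂ B hB),
      ← ofReal_integral_eq_lintegral_ofReal hXi.integrableOn (.of_forall hX0),
      ENNReal.toReal_ofReal (integral_nonneg hX0), measureReal_ennreal_smul_apply,
      ENNReal.toReal_ofReal hE0, mul_comm (∫ ω, X ω ∂μ)]
    exact abs_setIntegral_sub_mul_integral_le_alphaCoef hm₁ μ hX ha hXa hB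
  have hle := abs_integral_sub_integral_le_of_abs_measureReal_sub_le hm₂ _ _ hY hb hYb hclose
  rw [integral_smul_measure, ENNReal.toReal_ofReal hE0,
    integral_withDensity_eq_integral_toReal_smul hX'.ennreal_ofReal
      (.of_forall fun _ => ENNReal.ofReal_lt_top)] at hle
  rw [covariance_eq_sub hX2 hY2]
  simpa only [ENNReal.toReal_ofReal (hX0 _), smul_eq_mul] using! hle

theorem abs_covariance_le_alphaCoef_of_abs_le (hX : Measurable[m₁] X) (hY : Measurable[m₂] Y)
    {a : ℝ} (ha : 0 ≤ a) (hXa : ∀ ω, |X ω| ≤ a) (hYa : ∀ ω, |Y ω| ≤ a) :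
    |cov[X, Y; μ]| ≤ 4 * a ^ 2 * alphaCoef μ m₁ m₂ := by
  have hinteg : ∀ {Z : Ω → ℝ}, Measurable Z → (∀ ω, |Z ω| ≤ a) → Integrable Z μ := fun hZ hZa =>
    .of_bound hZ.aestronglyMeasurable a (.of_forall hZa)
  have hshift : ∀ {x : ℝ}, |x| ≤ a → x + a ∈ Set.Icc 0 (2 * a) := fun hx =>
    ⟨by linarith [neg_le_of_abs_le hx], by linarith [le_of_abs_le hx]⟩
  have h := abs_covariance_le_alphaCoef_of_mem_Icc hm₁ hm₂ μ (hX.add_const a) (hY.add_const a)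
    (by positivity) (by positivity) (fun ω => hshift (hXa ω)) (fun ω => hshift (hYa ω))
  rw [covariance_add_const_left (hinteg (hX.mono hm₁ le_rfl) hXa),
    covariance_add_const_right (hinteg (hY.mono hm₂ le_rfl) hYa)] at h
  linarith

theorem abs_covariance_le_of_truncation (hX : Measurable[m₁] X) (hY : Measurable[m₂] Y)
    {a p B : ℝ} (ha : 0 < a) (hp : 2 ≤ p) (hXp : MemLp X (ENNReal.ofReal p) μ)
    (hYp : MemLp Y (ENNReal.ofReal p) μ) (hXB : ∫ ω, |X ω| ^ p ∂μ ≤ B)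
    (hYB : ∫ ω, |Y ω| ^ p ∂μ ≤ B) :
    |cov[X, Y; μ]| ≤ 4 * a ^ 2 * alphaCoef μ m₁ m₂ + 4 * B * a ^ (2 - p) := by
  have hmeas : Measurable (Set.indicator (Set.Ioc (-a) a) (id : ℝ → ℝ)) :=
    measurable_id.indicator measurableSet_Ioc
  have hbound : ∀ (Z : Ω → ℝ) ω, |truncation Z a ω| ≤ a := fun Z ω =>
    (abs_truncation_le_bound Z a ω).trans_eq (abs_of_pos ha)
  have htrunc := abs_covariance_le_alphaCoef_of_abs_le hm₁ hm₂ μ (hmeas.comp hX) (hmeas.comp hY)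
    ha.le (hbound X) (hbound Y)
  have hdiff := abs_covariance_sub_covariance_truncation_le μ ha hp hXp hYp hXB hYB
  have htri := abs_add_le (cov[X, Y; μ] - cov[truncation X a, truncation Y a; μ])
    cov[truncation X a, truncation Y a; μ]
  rw [sub_add_cancel] at htri
  exact htri.trans ((add_le_add hdiff htrunc).trans_eq (add_comm _ _))

/-- **Davydov's covariance inequality**. -/
theorem abs_covariance_le_alphaCoef_rpow (hX : Measurable[m₁] X) (hY : Measurable[m₂] Y)
    {δ B : ℝ} (hδ : 0 < δ) (hXp : MemLp X (ENNReal.ofReal (2 + δ)) μ)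
    (hYp : MemLp Y (ENNReal.ofReal (2 + δ)) μ) (hXB : ∫ ω, |X ω| ^ (2 + δ) ∂μ ≤ B)
    (hYB : ∫ ω, |Y ω| ^ (2 + δ) ∂μ ≤ B) :
    |cov[X, Y; μ]| ≤ 4 * (1 + B) * alphaCoef μ m₁ m₂ ^ (δ / (2 + δ)) := by
  -- The truncation level `a = x ^ (-1 / (2 + δ))` balances the two error terms; taking `x` above
  -- the mixing coefficient covers the case in which that coefficient vanishes.
  have hlevel : ∀ x ∈ Set.Ioi (alphaCoef μ m₁ m₂),
      |cov[X, Y; μ]| ≤ 4 * (1 + B) * x ^ (δ / (2 + δ)) := by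
    intro x hx
    have hx0 : 0 < x := (alphaCoef_nonneg m₁ m₂ μ).trans_lt hx
    have hsq : (x ^ (-(1 / (2 + δ)))) ^ 2 * x = x ^ (δ / (2 + δ)) := by
      rw [← Real.rpow_mul_natCast hx0.le, ← Real.rpow_add_one hx0.ne']
      congr 1
      push_cast
      field
    have htail : (x ^ (-(1 / (2 + δ)))) ^ (2 - (2 + δ)) = x ^ (δ / (2 + δ)) := by
      rw [← Real.rpow_mul hx0.le]
      congr 1
      field
    calc |cov[X, Y; μ]|
        ≤ 4 * (x ^ (-(1 / (2 + δ)))) ^ 2 * alphaCoef μ m₁ m₂ +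
          4 * B * (x ^ (-(1 / (2 + δ)))) ^ (2 - (2 + δ)) :=
          abs_covariance_le_of_truncation hm₁ hm₂ μ hX hY (by positivity) (by linarith) hXp hYp
            hXB hYB
      _ ≤ 4 * ((x ^ (-(1 / (2 + δ)))) ^ 2 * x) + 4 * B * x ^ (δ / (2 + δ)) := by
          rw [htail, mul_assoc 4]
          gcongr
          exact hx.le
      _ = 4 * (1 + B) * x ^ (δ / (2 + δ)) := by rw [hsq]; ring
  have hcont : ContinuousWithinAt (fun x => 4 * (1 + B) * x ^ (δ / (2 + δ)))
      (Set.Ioi (alphaCoef μ m₁ m₂)) (alphaCoef μ m₁ m₂) :=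
    ((Real.continuous_rpow_const (by positivity)).const_mul _).continuousWithinAt
  exact ge_of_tendsto hcont (eventually_mem_nhdsWithin.mono hlevel)

end CovarianceInequality

section BoundedInProbability

open Asymptotics

variable {Ω : Type*} [MeasurableSpace Ω] {μ : Measure Ω} [IsFiniteMeasure μ]
  {A B C : ℕ → Ω → ℝ} {a b c : ℕ → ℝ}

theorem IsBigOp.of_imp₂ (hA : IsBigOp μ A a) (hB : IsBigOp μ B b)
    (h : ∀ M M' : ℝ, ∃ K : ℝ, ∀ᶠ T in atTop, ∀ ω,
      |A T ω| ≤ M * a T → |B T ω| ≤ M' * b T → |C T ω| ≤ K * c T) :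
    IsBigOp μ C c := by
  intro η hη
  obtain ⟨M, hM⟩ := hA (η / 2) (half_pos hη)
  obtain ⟨M', hM'⟩ := hB (η / 2) (half_pos hη)
  obtain ⟨K, hK⟩ := h M M'
  refine ⟨K, ?_⟩
  filter_upwards [hM, hM', hK] with T hA hB hC
  have hsub : {ω | K * c T < |C T ω|} ⊆ {ω | M * a T < |A T ω|} ∪ {ω | M' * b T < |B T ω|} := by
    intro ω hω
    contrapose! hω
    simp only [Set.mem_union, Set.mem_ofPred_eq, not_or, not_lt] at hω ⊢
    exact hC ω hω.1 hω.2
  calc μ.real {ω | K * c T < |C T ω|}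
      ≤ μ.real {ω | M * a T < |A T ω|} + μ.real {ω | M' * b T < |B T ω|} :=
        (measureReal_mono hsub).trans (measureReal_union_le _ _)
    _ ≤ η := by linarith

theorem IsBigOp.of_imp (hA : IsBigOp μ A a)
    (h : ∀ M : ℝ, ∃ K : ℝ, ∀ᶠ T in atTop, ∀ ω, |A T ω| ≤ M * a T → |B T ω| ≤ K * b T) :
    IsBigOp μ B b :=
  hA.of_imp₂ hA fun M _ => (h M).imp fun _ hK => hK.mono fun _ hT ω hω _ => hT ω hω

theorem IsBigOp.add (hA : IsBigOp μ A a) (hB : IsBigOp μ B a) :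
    IsBigOp μ (fun T ω => A T ω + B T ω) a :=
  hA.of_imp₂ hB fun M M' => ⟨M + M', .of_forall fun _ _ hAω hBω =>
    (abs_add_le _ _).trans ((add_le_add hAω hBω).trans_eq (add_mul _ _ _).symm)⟩

theorem IsBigOp.sub (hA : IsBigOp μ A a) (hB : IsBigOp μ B a) :
    IsBigOp μ (fun T ω => A T ω - B T ω) a :=
  hA.of_imp₂ hB fun M M' => ⟨M + M', .of_forall fun _ _ hAω hBω =>
    (abs_sub _ _).trans ((add_le_add hAω hBω).trans_eq (add_mul _ _ _).symm)⟩

theorem IsBigOp.mul (hA : IsBigOp μ A a) (hB : IsBigOp μ B b) :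
    IsBigOp μ (fun T ω => A T ω * B T ω) (fun T => a T * b T) :=
  hA.of_imp₂ hB fun M M' => ⟨M * M', .of_forall fun T ω hAω hBω => by
    rw [abs_mul, mul_mul_mul_comm]
    exact mul_le_mul hAω hBω (abs_nonneg _) ((abs_nonneg _).trans hAω)⟩

theorem IsBigOp.trans_isBigO (hA : IsBigOp μ A a) (hab : a =O[atTop] b) (hb : 0 ≤ᶠ[atTop] b) :
    IsBigOp μ A b := by
  obtain ⟨K, hK⟩ := hab.bound
  refine hA.of_imp fun M => ⟨|M| * K, ?_⟩
  filter_upwards [hK, hb] with T hT hbT ω hω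
  rw [Real.norm_eq_abs, Real.norm_of_nonneg hbT] at hT
  calc |A T ω| ≤ |M| * |a T| := hω.trans ((le_abs_self _).trans_eq (abs_mul _ _))
    _ ≤ |M| * K * b T := by
        rw [mul_assoc]
        exact mul_le_mul_of_nonneg_left hT (abs_nonneg M)

theorem IsBigOp.abs (hA : IsBigOp μ A a) : IsBigOp μ (fun T ω => |A T ω|) a :=
  hA.of_imp fun M => ⟨M, .of_forall fun _ _ hω => (abs_abs _).trans_le hω⟩

theorem IsBigOp.sum {ι : Type*} {A : ι → ℕ → Ω → ℝ} (s : Finset ι)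
    (hA : ∀ i ∈ s, IsBigOp μ (A i) a) : IsBigOp μ (fun T ω => ∑ i ∈ s, A i T ω) a := by
  classical
  induction s using Finset.induction_on with
  | empty => exact fun η hη => ⟨0, by simp [hη.le]⟩
  | insert i s hi ih =>
    simp only [Finset.sum_insert hi]
    exact (hA i (Finset.mem_insert_self i s)).add
      (ih fun j hj => hA j (Finset.mem_insert_of_mem hj))

theorem IsBigOp.norm_pi {ι : Type*} [Fintype ι] {E : ι → Type*}
    [∀ i, SeminormedAddCommGroup (E i)] {A : ℕ → Ω → ∀ i, E i}
    (hA : ∀ i, IsBigOp μ (fun T ω => ‖A T ω i‖) a) : IsBigOp μ (fun T ω => ‖A T ω‖) a := by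
  refine (IsBigOp.sum Finset.univ fun i _ => hA i).of_imp fun M =>
    ⟨M, .of_forall fun T ω hω => ?_⟩
  rw [abs_norm]
  refine le_trans ?_ ((le_abs_self _).trans hω)
  exact (pi_norm_le_iff_of_nonneg (Finset.sum_nonneg fun i _ => norm_nonneg _)).2 fun i =>
    Finset.single_le_sum (f := fun i => ‖A T ω i‖) (fun i _ => norm_nonneg _) (Finset.mem_univ i)

attribute [local instance] Matrix.normedAddCommGroup in
theorem IsBigOp.norm_matrix {m n : Type*} [Fintype m] [Fintype n] {A : ℕ → Ω → Matrix m n ℝ}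
    (hA : ∀ i j, IsBigOp μ (fun T ω => A T ω i j) a) : IsBigOp μ (fun T ω => ‖A T ω‖) a :=
  IsBigOp.norm_pi fun i => IsBigOp.norm_pi fun j => (hA i j).abs

theorem IsBigOp.of_eventually_abs_le_mul (hA : IsBigOp μ A a) (ha : Tendsto a atTop (𝓝 0))
    {K ε₀ : ℝ} (hK : 0 ≤ K) (hε₀ : 0 < ε₀)
    (h : ∀ᶠ T in atTop, ∀ ω, |A T ω| ≤ ε₀ → |B T ω| ≤ K * |A T ω|) : IsBigOp μ B a := by
  refine hA.of_imp fun M => ⟨K * M, ?_⟩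
  have hMa : Tendsto (fun T => M * a T) atTop (𝓝 0) := by simpa using ha.const_mul M
  filter_upwards [h, hMa.eventually_le_const hε₀] with T hT hMT ω hω
  rw [mul_assoc]
  exact (hT ω (hω.trans hMT)).trans (mul_le_mul_of_nonneg_left hω hK)

theorem IsBigOp.tendsto_measureReal_one {μ : Measure Ω} [IsProbabilityMeasure μ]
    (hA : IsBigOp μ A a) {S : ℕ → Set Ω}
    (h : ∀ M : ℝ, ∀ᶠ T in atTop, ∀ ω, |A T ω| ≤ M * a T → ω ∈ S T) :
    Tendsto (fun T => μ.real (S T)) atTop (𝓝 1) := by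
  rw [Metric.tendsto_nhds]
  intro η hη
  obtain ⟨M, hM⟩ := hA (η / 2) (half_pos hη)
  filter_upwards [hM, h M] with T hT hS
  have hsub : (S T)ᶜ ⊆ {ω | M * a T < |A T ω|} := fun ω hω =>
    not_le.1 fun hle => hω (hS ω hle)
  have hcompl : μ.real (S T)ᶜ ≤ η / 2 := (measureReal_mono hsub).trans hT
  have hunion : 1 ≤ μ.real (S T) + μ.real (S T)ᶜ := by
    simpa using measureReal_union_le (μ := μ) (S T) (S T)ᶜ
  rw [Real.dist_eq, abs_lt]
  constructor <;> linarith [measureReal_le_one (μ := μ) (s := S T)]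

end BoundedInProbability

section SampleMeans

theorem sum_comp_le_tsum_of_injOn {ι κ : Type*} {c : κ → ℝ} (hc0 : ∀ k, 0 ≤ c k)
    (hc : Summable c) {s : Finset ι} {f : ι → κ} (hf : Set.InjOn f s) :
    ∑ i ∈ s, c (f i) ≤ ∑' k, c k := by
  classical
  rw [← Finset.sum_image (f := c) hf]
  exact hc.sum_le_tsum _ fun k _ => hc0 k

theorem sum_sum_natDist_le {c : ℕ → ℝ} (hc0 : ∀ k, 0 ≤ c k) (hc : Summable c) (F : Finset ℕ) :
    ∑ s ∈ F, ∑ t ∈ F, c (Nat.dist s t) ≤ 2 * F.card * ∑' k, c k := by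
  have hrow : ∀ s ∈ F, ∑ t ∈ F, c (Nat.dist s t) ≤ 2 * ∑' k, c k := by
    intro s _
    rw [← Finset.sum_filter_add_sum_filter_not F (fun t => s ≤ t), two_mul]
    refine add_le_add (sum_comp_le_tsum_of_injOn hc0 hc ?_) (sum_comp_le_tsum_of_injOn hc0 hc ?_)
    all_goals
      intro a ha b hb hab
      simp only [Finset.coe_filter, Set.mem_ofPred_eq, Nat.dist] at ha hb hab
      omega
  calc ∑ s ∈ F, ∑ t ∈ F, c (Nat.dist s t)
      ≤ ∑ _s ∈ F, 2 * ∑' k, c k := Finset.sum_le_sum hrow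
    _ = 2 * F.card * ∑' k, c k := by rw [Finset.sum_const, nsmul_eq_mul]; ring

theorem measurable_sigmaBlock {Ω E : Type*} [MeasurableSpace E] {Z : ℕ → Ω → E} {a b t : ℕ}
    (ha : a ≤ t) (hb : t ≤ b) : Measurable[sigmaBlock Z a b] (Z t) :=
  (comap_measurable (Z t)).mono (le_iSup₂_of_le t ⟨ha, hb⟩ le_rfl) le_rfl

theorem sigmaBlock_le {Ω E : Type*} {m0 : MeasurableSpace Ω} [MeasurableSpace E] {Z : ℕ → Ω → E}
    {a b : ℕ} (hZ : ∀ t, a ≤ t → t ≤ b → Measurable (Z t)) : sigmaBlock Z a b ≤ m0 :=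
  iSup₂_le fun t ht => (hZ t ht.1 ht.2).comap_le

variable {Ω E : Type*} [MeasurableSpace Ω] [MeasurableSpace E] {μ : Measure Ω}

theorem variance_sum_le_of_abs_covariance_le [IsFiniteMeasure μ] {X : ℕ → Ω → ℝ} {F : Finset ℕ}
    {c : ℕ → ℝ} (hc0 : ∀ k, 0 ≤ c k) (hc : Summable c) (hX : ∀ t ∈ F, MemLp (X t) 2 μ)
    (hcov : ∀ s ∈ F, ∀ k, s + k ∈ F → |cov[X s, X (s + k); μ]| ≤ c k) :
    Var[∑ t ∈ F, X t; μ] ≤ 2 * F.card * ∑' k, c k := by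
  rw [variance_sum' hX]
  refine le_trans ?_ (sum_sum_natDist_le hc0 hc F)
  refine Finset.sum_le_sum fun s hs => Finset.sum_le_sum fun t ht => (le_abs_self _).trans ?_
  rcases le_total s t with hst | hts
  · obtain ⟨k, rfl⟩ := Nat.exists_eq_add_of_le hst
    simpa [Nat.dist_eq_sub_of_le hst] using hcov s hs k ht
  · obtain ⟨k, rfl⟩ := Nat.exists_eq_add_of_le hts
    rw [covariance_comm]
    simpa [Nat.dist_eq_sub_of_le_right hts] using hcov t ht k hs

theorem integral_sampleMean {X : ℕ → Ω → ℝ} {n : ℕ} {m : ℝ} (hn : 0 < n)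
    (hX : ∀ t ∈ Finset.Icc 1 n, Integrable (X t) μ) (hm : ∀ t ∈ Finset.Icc 1 n, ∫ ω, X t ω ∂μ = m) :
    ∫ ω, (n : ℝ)⁻¹ * ∑ t ∈ Finset.Icc 1 n, X t ω ∂μ = m := by
  have hn0 : (n : ℝ) ≠ 0 := by exact_mod_cast hn.ne'
  rw [integral_const_mul, integral_finsetSum _ hX, Finset.sum_congr rfl hm]
  simp [hn0]

theorem memLp_two_of_memLp_two_add [IsFiniteMeasure μ] {X : Ω → ℝ} {δ : ℝ} (hδ : 0 < δ)
    (hX : MemLp X (ENNReal.ofReal (2 + δ)) μ) : MemLp X 2 μ := by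
  refine hX.mono_exponent ?_
  rw [← ENNReal.ofReal_ofNat 2]
  exact ENNReal.ofReal_le_ofReal (by linarith)

variable [IsProbabilityMeasure μ]

theorem isBigOp_sub_integral_of_variance_le {S : ℕ → Ω → ℝ} {b : ℕ → ℝ} {K : ℝ} (hK : 0 ≤ K)
    (hS : ∀ᶠ T in atTop, MemLp (S T) 2 μ) (hb : ∀ᶠ T in atTop, 0 < b T)
    (hvar : ∀ᶠ T in atTop, Var[S T; μ] ≤ K * b T ^ 2) :
    IsBigOp μ (fun T ω => S T ω - ∫ ω, S T ω ∂μ) b := by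
  intro η hη
  have hM : 0 < √((K + 1) / η) := Real.sqrt_pos.2 (by positivity)
  refine ⟨√((K + 1) / η), ?_⟩
  filter_upwards [hS, hb, hvar] with T hST hbT hvarT
  have hMb : 0 < √((K + 1) / η) * b T := mul_pos hM hbT
  have hratio : Var[S T; μ] / (√((K + 1) / η) * b T) ^ 2 ≤ η := by
    rw [div_le_iff₀ (by positivity), mul_pow, Real.sq_sqrt (by positivity), ← mul_assoc,
      mul_div_cancel₀ _ hη.ne']
    exact hvarT.trans (mul_le_mul_of_nonneg_right (by linarith) (sq_nonneg _))
  refine ENNReal.toReal_le_of_le_ofReal hη.le ?_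
  calc μ {ω | √((K + 1) / η) * b T < |S T ω - ∫ ω, S T ω ∂μ|}
      ≤ μ {ω | √((K + 1) / η) * b T ≤ |S T ω - ∫ ω, S T ω ∂μ|} :=
        measure_mono (Set.ofPred_subset_ofPred.2 fun _ => le_of_lt)
    _ ≤ ENNReal.ofReal (Var[S T; μ] / (√((K + 1) / η) * b T) ^ 2) :=
        meas_ge_le_variance_div_sq hST hMb
    _ ≤ ENNReal.ofReal η := ENNReal.ofReal_le_ofReal hratio

theorem abs_covariance_comp_le_mixingCoef_rpow {Z : ℕ → ℕ → Ω → E} {T s k : ℕ} (hs : 1 ≤ s)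
    (hk : s + k ≤ T) (hZ : ∀ t, 1 ≤ t → t ≤ T → Measurable (Z T t)) {h : E → ℝ}
    (hh : Measurable h) {δ B : ℝ} (hδ : 0 < δ)
    (hp : ∀ t, 1 ≤ t → t ≤ T → MemLp (fun ω => h (Z T t ω)) (ENNReal.ofReal (2 + δ)) μ)
    (hB : ∀ t, 1 ≤ t → t ≤ T → ∫ ω, |h (Z T t ω)| ^ (2 + δ) ∂μ ≤ B) :
    |cov[fun ω => h (Z T s ω), fun ω => h (Z T (s + k) ω); μ]| ≤
      4 * (1 + B) * mixingCoef μ Z k ^ (δ / (2 + δ)) := by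
  have hsT : s ≤ T := by omega
  have hsk : 1 ≤ s + k := by omega
  have hB0 : 0 ≤ B := (integral_nonneg fun ω => by positivity).trans (hB s hs hsT)
  refine (abs_covariance_le_alphaCoef_rpow
    (sigmaBlock_le fun t h1 h2 => hZ t h1 (h2.trans hsT))
    (sigmaBlock_le fun t h1 h2 => hZ t (hsk.trans h1) h2) μ
    (hh.comp (measurable_sigmaBlock hs le_rfl)) (hh.comp (measurable_sigmaBlock le_rfl hk)) hδ
    (hp s hs hsT) (hp (s + k) hsk hk) (hB s hs hsT) (hB (s + k) hsk hk)).trans ?_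
  gcongr
  · exact alphaCoef_nonneg _ _ μ
  · exact alphaCoef_le_mixingCoef μ Z T s k

theorem variance_sum_comp_le_tsum_mixingCoef_rpow {Z : ℕ → ℕ → Ω → E} {T n : ℕ} (hn : n ≤ T)
    (hZ : ∀ t, 1 ≤ t → t ≤ T → Measurable (Z T t)) {h : E → ℝ} (hh : Measurable h) {δ B : ℝ}
    (hδ : 0 < δ) (hB0 : 0 ≤ B) (hmix : Summable fun k => mixingCoef μ Z k ^ (δ / (2 + δ)))
    (hp : ∀ t, 1 ≤ t → t ≤ T → MemLp (fun ω => h (Z T t ω)) (ENNReal.ofReal (2 + δ)) μ)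
    (hB : ∀ t, 1 ≤ t → t ≤ T → ∫ ω, |h (Z T t ω)| ^ (2 + δ) ∂μ ≤ B) :
    Var[fun ω => ∑ t ∈ Finset.Icc 1 n, h (Z T t ω); μ] ≤
      2 * n * ∑' k, 4 * (1 + B) * mixingCoef μ Z k ^ (δ / (2 + δ)) := by
  have hmem : ∀ t ∈ Finset.Icc 1 n, 1 ≤ t ∧ t ≤ T := fun t ht =>
    ⟨(Finset.mem_Icc.1 ht).1, (Finset.mem_Icc.1 ht).2.trans hn⟩
  have hvar := variance_sum_le_of_abs_covariance_le (X := fun t ω => h (Z T t ω))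
    (fun k => mul_nonneg (by positivity) (Real.rpow_nonneg (mixingCoef_nonneg μ Z k) _))
    (hmix.mul_left (4 * (1 + B)))
    (fun t ht => memLp_two_of_memLp_two_add hδ (hp t (hmem t ht).1 (hmem t ht).2))
    fun s hs k hk =>
      abs_covariance_comp_le_mixingCoef_rpow (hmem s hs).1 (hmem _ hk).2 hZ hh hδ hp hB
  simpa only [Nat.card_Icc, Nat.add_sub_cancel, Finset.sum_fn] using hvar

theorem isBigOp_sampleMean_sub {Z : ℕ → ℕ → Ω → E} {δ B m : ℝ} (hδ : 0 < δ)
    (hZ : ∀ T t, 1 ≤ t → t ≤ T → Measurable (Z T t))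
    (hmix : Summable fun k => mixingCoef μ Z k ^ (δ / (2 + δ))) {h : E → ℝ} (hh : Measurable h)
    (hp : ∀ T t, 1 ≤ t → t ≤ T → MemLp (fun ω => h (Z T t ω)) (ENNReal.ofReal (2 + δ)) μ)
    (hB : ∀ T t, 1 ≤ t → t ≤ T → ∫ ω, |h (Z T t ω)| ^ (2 + δ) ∂μ ≤ B)
    (hm : ∀ T t, 1 ≤ t → t ≤ T → ∫ ω, h (Z T t ω) ∂μ = m) {n : ℕ → ℕ}
    (hn : ∀ᶠ T in atTop, 0 < n T ∧ n T ≤ T) :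
    IsBigOp μ (fun T ω => (n T : ℝ)⁻¹ * ∑ t ∈ Finset.Icc 1 (n T), h (Z T t ω) - m)
      (fun T => (n T : ℝ) ^ (-(1 / 2) : ℝ)) := by
  have hB0 : 0 ≤ B := (integral_nonneg fun ω => by positivity).trans (hB 1 1 le_rfl le_rfl)
  have hmem : ∀ᶠ T in atTop, ∀ t ∈ Finset.Icc 1 (n T), 1 ≤ t ∧ t ≤ T := hn.mono fun T hT t ht =>
    ⟨(Finset.mem_Icc.1 ht).1, (Finset.mem_Icc.1 ht).2.trans hT.2⟩
  have hp2 : ∀ᶠ T in atTop, ∀ t ∈ Finset.Icc 1 (n T), MemLp (fun ω => h (Z T t ω)) 2 μ :=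
    hmem.mono fun T hT t ht => memLp_two_of_memLp_two_add hδ (hp T t (hT t ht).1 (hT t ht).2)
  set C : ℝ := ∑' k, 4 * (1 + B) * mixingCoef μ Z k ^ (δ / (2 + δ))
  have hC : 0 ≤ C := tsum_nonneg fun k =>
    mul_nonneg (by positivity) (Real.rpow_nonneg (mixingCoef_nonneg μ Z k) _)
  have hO := isBigOp_sub_integral_of_variance_le (μ := μ) (K := 2 * C) (by positivity)
    (S := fun T ω => (n T : ℝ)⁻¹ * ∑ t ∈ Finset.Icc 1 (n T), h (Z T t ω))
    (b := fun T => (n T : ℝ) ^ (-(1 / 2) : ℝ)) ?_ ?_ ?_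
  · refine hO.of_imp fun M => ⟨M, ?_⟩
    filter_upwards [hn, hmem, hp2] with T hT hmemT hpT ω hω
    rwa [integral_sampleMean hT.1 (fun t ht => (hpT t ht).integrable one_le_two) fun t ht =>
      hm T t (hmemT t ht).1 (hmemT t ht).2] at hω
  · exact hp2.mono fun T hpT => (memLp_finsetSum _ hpT).const_mul _
  · exact hn.mono fun T hT => Real.rpow_pos_of_pos (Nat.cast_pos.2 hT.1) _
  · filter_upwards [hn] with T hT
    have hpos : (0 : ℝ) < n T := Nat.cast_pos.2 hT.1
    have hrate : ((n T : ℝ) ^ (-(1 / 2) : ℝ)) ^ 2 = (n T : ℝ)⁻¹ := by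
      rw [← Real.rpow_mul_natCast hpos.le, ← Real.rpow_neg_one]
      norm_num
    have hvar := variance_sum_comp_le_tsum_mixingCoef_rpow hT.2 (hZ T) hh hδ hB0 hmix (hp T) (hB T)
    rw [variance_const_mul, hrate]
    calc (n T : ℝ)⁻¹ ^ 2 * Var[fun ω => ∑ t ∈ Finset.Icc 1 (n T), h (Z T t ω); μ]
        ≤ (n T : ℝ)⁻¹ ^ 2 * (2 * n T * C) := mul_le_mul_of_nonneg_left hvar (by positivity)
      _ = 2 * C * (n T : ℝ)⁻¹ := by field_simp

end SampleMeans

section CentredProcess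

open Matrix

variable {Ω : Type*} {N r : ℕ} [MeasurableSpace Ω] {μ : Measure Ω} {P : Panel Ω N r} {T t : ℕ}

/-- The assumptions on the first two moments in `Panel.FactorMoments`, without the normalization of
the loadings. -/
def Panel.FactorCovariances (P : Panel Ω N r) (μ : Measure Ω) : Prop :=
  (∃ α₀ : Fin r → ℝ, ∀ T t, 1 ≤ t → t ≤ T → t ≤ P.T0 T → P.factorMean μ T t = α₀) ∧
  (∀ i, 0 < P.σ i) ∧
  ∀ T t, 1 ≤ t → t ≤ T →
    (∀ i j, cov[fun ω => P.ε T t ω i, fun ω => P.ε T t ω j; μ] =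
      diagonal (fun i => P.σ i ^ 2) i j) ∧
    ∀ k l, cov[fun ω => P.F T t ω k, fun ω => P.F T t ω l; μ] = (1 : Matrix (Fin r) (Fin r) ℝ) k l

/-- The assumption `Panel.StationaryMixing` with strict stationarity weakened to a bound on the
moments of order `4 + 2δ` that is uniform in time and in the horizon. -/
def Panel.BoundedMixing (P : Panel Ω N r) (μ : Measure Ω) : Prop :=
  ∃ δ : ℝ, 0 < δ ∧
    (∃ B : ℝ, ∀ T t, 1 ≤ t → t ≤ T →
      MemLp (P.centred μ T t) (ENNReal.ofReal (4 + 2 * δ)) μ ∧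
      ∫ ω, ‖P.centred μ T t ω‖ ^ (4 + 2 * δ) ∂μ ≤ B) ∧
    Summable fun k => mixingCoef μ (P.centred μ) k ^ (δ / (2 + δ))

theorem Panel.FactorMoments.factorCovariances (h : P.FactorMoments μ) : P.FactorCovariances μ :=
  ⟨h.1, h.2.1, fun T t ht htT => (h.2.2.1 T t ht htT).2.2⟩

theorem Panel.StationaryMixing.identDistrib_centred (h : P.StationaryMixing μ) (ht : 1 ≤ t)
    (htT : t ≤ T) : IdentDistrib (P.centred μ T t) (P.centred μ 1 1) μ μ := by
  have hblock := (h.1 1 T 1 (t - 1) 0 (by omega) (by omega)).comp (measurable_pi_apply (0 : Fin 1))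
  simpa [Function.comp_def, Nat.sub_add_cancel ht] using hblock

theorem Panel.StationaryMixing.boundedMixing (h : P.StationaryMixing μ) : P.BoundedMixing μ := by
  obtain ⟨δ, hδ, hmom, hsum⟩ := h.2
  refine ⟨δ, hδ, ⟨∫ ω, ‖P.centred μ 1 1 ω‖ ^ (4 + 2 * δ) ∂μ, fun T t ht htT => ⟨?_, ?_⟩⟩, hsum⟩
  · exact .of_fst_snd ⟨.of_eval (hmom T t ht htT).1, .of_eval (hmom T t ht htT).2⟩
  · have hnorm : Measurable fun w : (Fin r → ℝ) × (Fin N → ℝ) => ‖w‖ ^ (4 + 2 * δ) := by fun_prop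
    exact ((h.identDistrib_centred ht htT).comp hnorm).integral_eq.le

theorem Panel.LinearFactorModel.measurable_centred (h : P.LinearFactorModel μ) (ht : 1 ≤ t)
    (htT : t ≤ T) : Measurable (P.centred μ T t) :=
  ((h T t ht htT).1.sub_const _).prodMk (h T t ht htT).2.1

theorem memLp_of_abs_le_max_sq {E : Type*} [NormedAddCommGroup E] [IsFiniteMeasure μ]
    {f : Ω → ℝ} {W : Ω → E} {K p : ℝ} (hp : 0 < p) (hK : 0 ≤ K) (hf : AEStronglyMeasurable f μ)
    (hW : MemLp W (ENNReal.ofReal (2 * p)) μ) (h : ∀ ω, |f ω| ≤ K * max 1 ‖W ω‖ ^ 2) :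
    MemLp f (ENNReal.ofReal p) μ ∧
      ∫ ω, |f ω| ^ p ∂μ ≤ K ^ p * (μ.real Set.univ + ∫ ω, ‖W ω‖ ^ (2 * p) ∂μ) := by
  have hWint : Integrable (fun ω => ‖W ω‖ ^ (2 * p)) μ := by
    simpa [hp.le] using hW.integrable_norm_rpow (by simpa using hp) ENNReal.ofReal_ne_top
  have hdom : Integrable (fun ω => K ^ p * (1 + ‖W ω‖ ^ (2 * p))) μ :=
    ((integrable_const 1).add hWint).const_mul _
  have hle : ∀ ω, |f ω| ^ p ≤ K ^ p * (1 + ‖W ω‖ ^ (2 * p)) := fun ω => by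
    calc |f ω| ^ p ≤ (K * max 1 ‖W ω‖ ^ 2) ^ p :=
          Real.rpow_le_rpow (abs_nonneg _) (h ω) hp.le
      _ = K ^ p * max 1 ‖W ω‖ ^ (2 * p) := by
          rw [Real.mul_rpow hK (by positivity), ← Real.rpow_natCast_mul (by positivity)]
          norm_cast
      _ ≤ K ^ p * (1 + ‖W ω‖ ^ (2 * p)) := by
          refine mul_le_mul_of_nonneg_left ?_ (by positivity)
          rcases le_total ‖W ω‖ 1 with h1 | h1
          · simp only [max_eq_left h1, Real.one_rpow, le_add_iff_nonneg_right]
            positivity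
          · simp [max_eq_right h1]
  have hint : Integrable (fun ω => |f ω| ^ p) μ := by
    refine hdom.mono' (hf.norm.aemeasurable.pow_const p).aestronglyMeasurable ?_
    filter_upwards with ω
    rw [Real.norm_of_nonneg (by positivity)]
    exact hle ω
  constructor
  · rw [← integrable_norm_rpow_iff hf (by simpa using hp) ENNReal.ofReal_ne_top]
    simpa [hp.le] using hint
  · calc ∫ ω, |f ω| ^ p ∂μ ≤ ∫ ω, K ^ p * (1 + ‖W ω‖ ^ (2 * p)) ∂μ :=
          integral_mono hint hdom hle
      _ = K ^ p * (μ.real Set.univ + ∫ ω, ‖W ω‖ ^ (2 * p) ∂μ) := by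
          rw [integral_const_mul, integral_add (integrable_const 1) hWint]
          simp

theorem Panel.BoundedMixing.memLp_two [IsFiniteMeasure μ] (h : P.BoundedMixing μ) (ht : 1 ≤ t)
    (htT : t ≤ T) : MemLp (P.centred μ T t) 2 μ := by
  obtain ⟨δ, hδ, ⟨B, hB⟩, -⟩ := h
  exact (hB T t ht htT).1.mono_exponent (by
    rw [← ENNReal.ofReal_ofNat 2]
    exact ENNReal.ofReal_le_ofReal (by linarith))

theorem Panel.BoundedMixing.isBigOp_sampleMean [IsProbabilityMeasure μ] (hmix : P.BoundedMixing μ)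
    (hmodel : P.LinearFactorModel μ) (hT0 : ∀ᶠ T in atTop, 0 < P.T0 T ∧ P.T0 T ≤ T)
    {h : (Fin r → ℝ) × (Fin N → ℝ) → ℝ} (hh : Measurable h) {K m : ℝ} (hK : 0 ≤ K)
    (hle : ∀ w, |h w| ≤ K * max 1 ‖w‖ ^ 2)
    (hm : ∀ T t, 1 ≤ t → t ≤ T → ∫ ω, h (P.centred μ T t ω) ∂μ = m) :
    IsBigOp μ
      (fun T ω => (P.T0 T : ℝ)⁻¹ * ∑ t ∈ Finset.Icc 1 (P.T0 T), h (P.centred μ T t ω) - m)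
      (fun T => (P.T0 T : ℝ) ^ (-(1 / 2) : ℝ)) := by
  obtain ⟨δ, hδ, ⟨B, hB⟩, hsum⟩ := hmix
  rw [show 4 + 2 * δ = 2 * (2 + δ) by ring] at hB
  have hmeas : ∀ T t, 1 ≤ t → t ≤ T → Measurable (P.centred μ T t) :=
    fun T t => hmodel.measurable_centred
  have hmem := fun T t (ht : 1 ≤ t) (htT : t ≤ T) =>
    memLp_of_abs_le_max_sq (by linarith) hK (hh.comp (hmeas T t ht htT)).aestronglyMeasurable
      (hB T t ht htT).1 fun ω => hle _
  refine isBigOp_sampleMean_sub hδ hmeas hsum hh (fun T t ht htT => (hmem T t ht htT).1)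
    (B := K ^ (2 + δ) * (μ.real Set.univ + B)) (fun T t ht htT => ?_) hm hT0
  exact (hmem T t ht htT).2.trans (by gcongr; exact (hB T t ht htT).2)

end CentredProcess

section SampleCovariance

open Matrix

variable {Ω : Type*} {N r : ℕ}

/-- The deviation of the untreated outcomes from their mean, as a function of the centred factors
and the errors. -/
noncomputable def disturbance (Λ : Matrix (Fin N) (Fin r) ℝ) :
    (Fin r → ℝ) × (Fin N → ℝ) →L[ℝ] (Fin N → ℝ) :=
  (LinearMap.toContinuousLinearMap Λ.mulVecLin).coprod (.id ℝ _)

theorem disturbance_apply (Λ : Matrix (Fin N) (Fin r) ℝ) (w : (Fin r → ℝ) × (Fin N → ℝ)) :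
    disturbance Λ w = Λ *ᵥ w.1 + w.2 :=
  rfl

theorem sum_mul_sub_mean {n : ℕ} (hn : 0 < n) (x y : ℕ → ℝ) :
    (n : ℝ)⁻¹ * ∑ t ∈ Finset.Icc 1 n, (x t - (n : ℝ)⁻¹ * ∑ s ∈ Finset.Icc 1 n, x s) *
      (y t - (n : ℝ)⁻¹ * ∑ s ∈ Finset.Icc 1 n, y s) =
    (n : ℝ)⁻¹ * ∑ t ∈ Finset.Icc 1 n, x t * y t -
      ((n : ℝ)⁻¹ * ∑ s ∈ Finset.Icc 1 n, x s) * ((n : ℝ)⁻¹ * ∑ s ∈ Finset.Icc 1 n, y s) := by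
  simp only [sub_mul, mul_sub, Finset.sum_sub_distrib, ← Finset.sum_mul, ← Finset.mul_sum,
    Finset.sum_const, Nat.card_Icc, Nat.add_sub_cancel, nsmul_eq_mul]
  field_simp
  ring

theorem integral_eq_zero_of_condExp_eq_zero {m m0 : MeasurableSpace Ω} {μ : Measure[m0] Ω}
    (hm : m ≤ m0) [SigmaFinite (μ.trim hm)] {X : Ω → ℝ} (h : μ[X | m] =ᵐ[μ] 0) :
    ∫ ω, X ω ∂μ = 0 := by
  rw [← integral_condExp hm, integral_congr_ae h]
  simp

theorem covariance_eq_zero_of_condExp_eq_zero {m m0 : MeasurableSpace Ω} {μ : Measure[m0] Ω}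
    [IsProbabilityMeasure μ] (hm : m ≤ m0) {X Y : Ω → ℝ} (hXm : StronglyMeasurable[m] X)
    (hX : MemLp X 2 μ) (hY : MemLp Y 2 μ) (h : μ[Y | m] =ᵐ[μ] 0) : cov[X, Y; μ] = 0 := by
  have hXY : μ[X * Y | m] =ᵐ[μ] 0 := by
    filter_upwards [h, condExp_mul_of_stronglyMeasurable_left hXm (hX.integrable_mul hY)
      (hY.integrable one_le_two)] with ω hω hmul
    simp [hmul, hω]
  rw [covariance_eq_sub hX hY, integral_eq_zero_of_condExp_eq_zero hm h,
    integral_eq_zero_of_condExp_eq_zero hm hXY, mul_zero, sub_zero]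

variable [MeasurableSpace Ω] {μ : Measure Ω} {P : Panel Ω N r} {T t : ℕ}

theorem Panel.Y_eq_disturbance (hcons : P.Consistency) (hmodel : P.LinearFactorModel μ)
    (ht : 1 ≤ t) (htT : t ≤ T) (htT0 : t ≤ P.T0 T) (ω : Ω) :
    P.Y T t ω = P.Λ *ᵥ P.factorMean μ T t + disturbance P.Λ (P.centred μ T t ω) := by
  ext i
  have hX : P.X T t = 0 := by simp [Panel.X, htT0]
  rw [(hcons T t ht htT ω i).1 hX, (hmodel T t ht htT).2.2.1 ω i]
  simp only [disturbance_apply, Panel.centred, mulVec_sub, Pi.add_apply, Pi.sub_apply]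
  rw [← add_assoc, add_sub_cancel]
  rfl

theorem Panel.preCov_apply_eq (hcons : P.Consistency) (hmodel : P.LinearFactorModel μ)
    {α₀ : Fin r → ℝ} (hα₀ : ∀ T t, 1 ≤ t → t ≤ T → t ≤ P.T0 T → P.factorMean μ T t = α₀)
    (hT0 : 0 < P.T0 T) (hT : P.T0 T ≤ T) (ω : Ω) (i j : Fin N) :
    P.preCov T ω i j =
      (P.T0 T : ℝ)⁻¹ * ∑ t ∈ Finset.Icc 1 (P.T0 T),
        disturbance P.Λ (P.centred μ T t ω) i * disturbance P.Λ (P.centred μ T t ω) j -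
      ((P.T0 T : ℝ)⁻¹ * ∑ t ∈ Finset.Icc 1 (P.T0 T), disturbance P.Λ (P.centred μ T t ω) i) *
        ((P.T0 T : ℝ)⁻¹ * ∑ t ∈ Finset.Icc 1 (P.T0 T), disturbance P.Λ (P.centred μ T t ω) j) := by
  have hn : (P.T0 T : ℝ) ≠ 0 := by positivity
  have hY : ∀ t ∈ Finset.Icc 1 (P.T0 T), ∀ i,
      P.Y T t ω i = (P.Λ *ᵥ α₀) i + disturbance P.Λ (P.centred μ T t ω) i := fun t ht i => by
    obtain ⟨h1, h2⟩ := Finset.mem_Icc.1 ht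
    rw [Panel.Y_eq_disturbance hcons hmodel h1 (h2.trans hT) h2, hα₀ T t h1 (h2.trans hT) h2,
      Pi.add_apply]
  have hmean : ∀ i, P.preMean T ω i = (P.Λ *ᵥ α₀) i +
      (P.T0 T : ℝ)⁻¹ * ∑ t ∈ Finset.Icc 1 (P.T0 T), disturbance P.Λ (P.centred μ T t ω) i := by
    intro i
    simp only [Panel.preMean, Pi.smul_apply, Finset.sum_apply, smul_eq_mul]
    rw [Finset.sum_congr rfl fun t ht => hY t ht i, Finset.sum_add_distrib, mul_add]
    simp [inv_mul_cancel_left₀ hn]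
  rw [← sum_mul_sub_mean hT0]
  simp only [Panel.preCov, Matrix.smul_apply, Matrix.sum_apply, Matrix.vecMulVec_apply,
    Pi.sub_apply, smul_eq_mul]
  refine congrArg _ (Finset.sum_congr rfl fun t ht => ?_)
  rw [hmean i, hmean j, hY t ht i, hY t ht j, add_sub_add_left_eq_sub, add_sub_add_left_eq_sub]

theorem covariance_disturbance [IsProbabilityMeasure μ]
    {W : Ω → (Fin r → ℝ) × (Fin N → ℝ)} (hW : MemLp W 2 μ)
    {Ψ : Matrix (Fin N) (Fin N) ℝ}
    (h11 : ∀ k l, cov[fun ω => (W ω).1 k, fun ω => (W ω).1 l; μ] =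
      (1 : Matrix (Fin r) (Fin r) ℝ) k l)
    (h22 : ∀ i j, cov[fun ω => (W ω).2 i, fun ω => (W ω).2 j; μ] = Ψ i j)
    (h12 : ∀ k i, cov[fun ω => (W ω).1 k, fun ω => (W ω).2 i; μ] = 0)
    (Λ : Matrix (Fin N) (Fin r) ℝ) (i j : Fin N) :
    cov[fun ω => disturbance Λ (W ω) i, fun ω => disturbance Λ (W ω) j; μ] =
      (Λ * Λᵀ + Ψ) i j := by
  have h1 : ∀ i k, MemLp (fun ω => Λ i k * (W ω).1 k) 2 μ :=
    fun i k => (hW.fst.eval k).const_mul _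
  have hsum : ∀ i, MemLp (fun ω => ∑ k, Λ i k * (W ω).1 k) 2 μ :=
    fun i => memLp_finsetSum _ fun k _ => h1 i k
  have h2 : ∀ i, MemLp (fun ω => (W ω).2 i) 2 μ := hW.snd.eval
  have hsplit : ∀ i, (fun ω => disturbance Λ (W ω) i) =
      (fun ω => ∑ k, Λ i k * (W ω).1 k) + fun ω => (W ω).2 i := fun i => rfl
  have h21 : ∀ i k, cov[fun ω => (W ω).2 i, fun ω => (W ω).1 k; μ] = 0 :=
    fun i k => covariance_comm (μ := μ) .. ▸ h12 k i
  rw [hsplit, hsplit, covariance_add_left (hsum i) (h2 i) ((hsum j).add (h2 j)),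
    covariance_add_right (hsum i) (hsum j) (h2 j), covariance_add_right (h2 i) (hsum j) (h2 j),
    covariance_fun_sum_fun_sum (h1 i) (h1 j), covariance_fun_sum_left (h1 i) (h2 j),
    covariance_fun_sum_right (h1 j) (h2 i)]
  simp [covariance_const_mul_left, covariance_const_mul_right, h11, h22, h12, h21,
    Matrix.mul_apply, Matrix.one_apply, mul_comm]

variable [IsProbabilityMeasure μ]

theorem Panel.BoundedMixing.memLp_two_factor (hmix : P.BoundedMixing μ) (ht : 1 ≤ t) (htT : t ≤ T)
    (k : Fin r) : MemLp (fun ω => P.F T t ω k) 2 μ := by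
  simpa [Panel.centred, Pi.add_def] using
    ((hmix.memLp_two ht htT).fst.eval k).add (memLp_const (P.factorMean μ T t k))

theorem Panel.integral_disturbance_centred (hmix : P.BoundedMixing μ)
    (hmodel : P.LinearFactorModel μ) (ht : 1 ≤ t) (htT : t ≤ T) :
    ∫ ω, disturbance P.Λ (P.centred μ T t ω) ∂μ = 0 := by
  obtain ⟨hF, -, -, -, hε⟩ := hmodel T t ht htT
  have hint : Integrable (P.centred μ T t) μ := (hmix.memLp_two ht htT).integrable one_le_two
  have hfst : ∫ ω, (P.centred μ T t ω).1 ∂μ = 0 := by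
    ext k
    rw [eval_integral fun l => hint.fst.eval l]
    simp only [Panel.centred, Pi.sub_apply]
    rw [integral_sub ((hmix.memLp_two_factor ht htT k).integrable one_le_two)
      (integrable_const _)]
    simp [Panel.factorMean]
  have hsnd : ∫ ω, (P.centred μ T t ω).2 ∂μ = 0 := by
    ext i
    rw [eval_integral fun j => hint.snd.eval j]
    exact integral_eq_zero_of_condExp_eq_zero hF.comap_le (hε i).2
  rw [ContinuousLinearMap.integral_comp_comm _ hint,
    show ∫ ω, P.centred μ T t ω ∂μ = 0 from Prod.ext (by rw [fst_integral hint, hfst]; rfl)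
      (by rw [snd_integral hint, hsnd]; rfl), map_zero]

theorem Panel.integral_disturbance_centred_apply (hmix : P.BoundedMixing μ)
    (hmodel : P.LinearFactorModel μ) (ht : 1 ≤ t) (htT : t ≤ T) (i : Fin N) :
    ∫ ω, disturbance P.Λ (P.centred μ T t ω) i ∂μ = 0 := by
  have hint : Integrable (fun ω => disturbance P.Λ (P.centred μ T t ω)) μ :=
    (disturbance P.Λ).integrable_comp ((hmix.memLp_two ht htT).integrable one_le_two)
  rw [← eval_integral fun j => hint.eval j, integral_disturbance_centred hmix hmodel ht htT,
    Pi.zero_apply]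

theorem Panel.integral_disturbance_centred_mul (hmix : P.BoundedMixing μ)
    (hmodel : P.LinearFactorModel μ) (hcov : P.FactorCovariances μ) (ht : 1 ≤ t) (htT : t ≤ T)
    (i j : Fin N) :
    ∫ ω, disturbance P.Λ (P.centred μ T t ω) i * disturbance P.Λ (P.centred μ T t ω) j ∂μ =
      (P.Λ * P.Λᵀ + diagonal fun i => P.σ i ^ 2) i j := by
  obtain ⟨hF, -, -, -, hε⟩ := hmodel T t ht htT
  obtain ⟨hcovε, hcovF⟩ := hcov.2.2 T t ht htT
  have hW := hmix.memLp_two ht htT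
  have hFint : ∀ k, Integrable (fun ω => P.F T t ω k) μ :=
    fun k => (hmix.memLp_two_factor ht htT k).integrable one_le_two
  have hcovFε : ∀ k i, cov[fun ω => P.F T t ω k, fun ω => P.ε T t ω i; μ] = 0 := fun k i =>
    covariance_eq_zero_of_condExp_eq_zero hF.comap_le
      ((measurable_pi_apply k).comp (comap_measurable (P.F T t))).stronglyMeasurable
      (hmix.memLp_two_factor ht htT k) (hW.snd.eval i) (hε i).2
  have hdist : ∀ i, MemLp (fun ω => disturbance P.Λ (P.centred μ T t ω) i) 2 μ :=
    fun i => ((disturbance P.Λ).comp_memLp' hW).eval i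
  rw [← covariance_disturbance hW (fun k l => ?_) hcovε (fun k i => ?_),
    covariance_eq_sub (hdist i) (hdist j), integral_disturbance_centred_apply hmix hmodel ht htT,
    zero_mul, sub_zero]
  · rfl
  · simp only [Panel.centred, Pi.sub_apply]
    rw [covariance_sub_const_left (hFint k), covariance_sub_const_right (hFint l), hcovF]
  · simp only [Panel.centred, Pi.sub_apply]
    rw [covariance_sub_const_left (hFint k), hcovFε]

theorem abs_disturbance_mul_le (Λ : Matrix (Fin N) (Fin r) ℝ) (w : (Fin r → ℝ) × (Fin N → ℝ))
    (i j : Fin N) :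
    |disturbance Λ w i * disturbance Λ w j| ≤ ‖disturbance Λ‖ ^ 2 * max 1 ‖w‖ ^ 2 := by
  have hle : ∀ i, |disturbance Λ w i| ≤ ‖disturbance Λ‖ * max 1 ‖w‖ := fun i =>
    (norm_le_pi_norm (disturbance Λ w) i).trans
      (((disturbance Λ).le_opNorm w).trans (by gcongr; exact le_max_right _ _))
  calc |disturbance Λ w i * disturbance Λ w j|
      ≤ (‖disturbance Λ‖ * max 1 ‖w‖) * (‖disturbance Λ‖ * max 1 ‖w‖) := by
        rw [abs_mul]
        exact mul_le_mul (hle i) (hle j) (abs_nonneg _) (by positivity)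
    _ = ‖disturbance Λ‖ ^ 2 * max 1 ‖w‖ ^ 2 := by ring

theorem abs_disturbance_le (Λ : Matrix (Fin N) (Fin r) ℝ) (w : (Fin r → ℝ) × (Fin N → ℝ))
    (i : Fin N) : |disturbance Λ w i| ≤ ‖disturbance Λ‖ * max 1 ‖w‖ ^ 2 :=
  calc |disturbance Λ w i| ≤ ‖disturbance Λ w‖ := norm_le_pi_norm (disturbance Λ w) i
    _ ≤ ‖disturbance Λ‖ * ‖w‖ := (disturbance Λ).le_opNorm w
    _ ≤ ‖disturbance Λ‖ * max 1 ‖w‖ ^ 2 := by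
        gcongr
        exact (le_max_right 1 _).trans (le_self_pow₀ (le_max_left 1 _) two_ne_zero)

attribute [local instance] Matrix.normedAddCommGroup

theorem Panel.isBigOp_norm_preCov_sub (hcons : P.Consistency) (hmodel : P.LinearFactorModel μ)
    (hcov : P.FactorCovariances μ) (hmix : P.BoundedMixing μ)
    (hT0 : ∀ᶠ T in atTop, 0 < P.T0 T ∧ P.T0 T ≤ T) :
    IsBigOp μ (fun T ω => ‖P.preCov T ω - (P.Λ * P.Λᵀ + diagonal fun i => P.σ i ^ 2)‖)
      (fun T => (P.T0 T : ℝ) ^ (-(1 / 2) : ℝ)) := by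
  obtain ⟨α₀, hα₀⟩ := hcov.1
  have hmeas : ∀ i, Measurable fun w => disturbance P.Λ w i :=
    fun i => (measurable_pi_apply i).comp (disturbance P.Λ).measurable
  have hmean : ∀ i, IsBigOp μ (fun T ω => (P.T0 T : ℝ)⁻¹ *
      ∑ t ∈ Finset.Icc 1 (P.T0 T), disturbance P.Λ (P.centred μ T t ω) i)
      (fun T => (P.T0 T : ℝ) ^ (-(1 / 2) : ℝ)) := fun i => by
    simpa only [sub_zero] using hmix.isBigOp_sampleMean hmodel hT0 (hmeas i) (norm_nonneg _)
      (fun w => abs_disturbance_le P.Λ w i)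
      (fun T t ht htT => integral_disturbance_centred_apply hmix hmodel ht htT i)
  have hrate : (fun T => (P.T0 T : ℝ) ^ (-(1 / 2) : ℝ) * (P.T0 T : ℝ) ^ (-(1 / 2) : ℝ))
      =O[atTop] fun T => (P.T0 T : ℝ) ^ (-(1 / 2) : ℝ) := by
    refine .of_bound 1 (hT0.mono fun T hT => ?_)
    rw [norm_mul, Real.norm_of_nonneg (by positivity)]
    exact mul_le_mul_of_nonneg_right (Real.rpow_le_one_of_one_le_of_nonpos
      (by exact_mod_cast hT.1) (by norm_num)) (by positivity)
  refine .norm_matrix fun i j => ?_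
  have hprod := (hmix.isBigOp_sampleMean hmodel hT0 ((hmeas i).mul (hmeas j)) (sq_nonneg _)
    (fun w => abs_disturbance_mul_le P.Λ w i j)
    (fun T t ht htT => integral_disturbance_centred_mul hmix hmodel hcov ht htT i j)).sub
      (((hmean i).mul (hmean j)).trans_isBigO hrate (.of_forall fun T => by positivity))
  refine hprod.of_imp fun M => ⟨M, hT0.mono fun T hT ω hω => ?_⟩
  rwa [Matrix.sub_apply, preCov_apply_eq hcons hmodel hα₀ hT.1 hT.2 ω i j, sub_right_comm]

end SampleCovariance

section Rates

open Asymptotics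

theorem isBigO_rpow_neg_of_tendsto_div {n : ℕ → ℕ} {ρ p d : ℝ} (hρ : 0 < ρ)
    (hn : Tendsto (fun T : ℕ => (n T : ℝ) / T) atTop (𝓝 ρ)) (hp : 0 ≤ p) (hd : d ≤ p) :
    (fun T => (n T : ℝ) ^ (-p)) =O[atTop] fun T : ℕ => (T : ℝ) ^ (-d) := by
  refine .of_bound ((ρ / 2) ^ (-p)) ?_
  filter_upwards [hn.eventually_const_le (half_lt_self hρ), eventually_ge_atTop 1] with T hT hT1
  have hT1' : (1 : ℝ) ≤ T := by exact_mod_cast hT1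
  have hle : ρ / 2 * T ≤ n T := (le_div_iff₀ (by positivity)).1 hT
  rw [Real.norm_of_nonneg (by positivity), Real.norm_of_nonneg (by positivity)]
  calc (n T : ℝ) ^ (-p) ≤ (ρ / 2 * T) ^ (-p) :=
        Real.rpow_le_rpow_of_nonpos (by positivity) hle (neg_nonpos.2 hp)
    _ = (ρ / 2) ^ (-p) * (T : ℝ) ^ (-p) := Real.mul_rpow (by positivity) (by positivity)
    _ ≤ (ρ / 2) ^ (-p) * (T : ℝ) ^ (-d) := by gcongr

variable {N : ℕ}

theorem tendsto_sqrt_log_atTop (hN : 0 < N) :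
    Tendsto (fun T : ℕ => √(2 * Real.log ((N : ℝ) * T))) atTop atTop :=
  Real.tendsto_sqrt_atTop.comp ((Real.tendsto_log_atTop.comp
    (tendsto_natCast_atTop_atTop.const_mul_atTop (Nat.cast_pos.2 hN))).const_mul_atTop two_pos)

theorem tendsto_sqrt_log_div_rpow {d : ℝ} (hd : 0 < d) :
    Tendsto (fun T : ℕ => √(2 * Real.log ((N : ℝ) * T)) / (T : ℝ) ^ d) atTop (𝓝 0) := by
  have hlog : Tendsto (fun x : ℝ => Real.log (N * x) / x ^ (2 * d)) atTop (𝓝 0) := by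
    rcases Nat.eq_zero_or_pos N with rfl | hN
    · simp
    have hd2 : 0 < 2 * d := by positivity
    have hsum := ((tendsto_const_nhds (x := Real.log N)).div_atTop
      (tendsto_rpow_atTop hd2)).add (isLittleO_log_rpow_atTop hd2).tendsto_div_nhds_zero
    rw [add_zero] at hsum
    refine hsum.congr' ((eventually_gt_atTop 0).mono fun x hx => ?_)
    simp only [Real.log_mul (Nat.cast_pos.2 hN).ne' hx.ne', add_div]
  have hsqrt := ((Real.continuous_sqrt.tendsto _).comp (hlog.const_mul 2)).comp
    tendsto_natCast_atTop_atTop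
  simp only [mul_zero, Real.sqrt_zero] at hsqrt
  refine hsqrt.congr fun T => ?_
  have hT : (T : ℝ) ^ (2 * d) = ((T : ℝ) ^ d) ^ 2 := by
    rw [mul_comm, Real.rpow_mul T.cast_nonneg, Real.rpow_two]
  rw [Function.comp_apply, Function.comp_apply, ← mul_div_assoc, hT,
    Real.sqrt_div' _ (sq_nonneg _), Real.sqrt_sq (by positivity)]

theorem tendsto_natCast_rpow_neg {d : ℝ} (hd : 0 < d) :
    Tendsto (fun T : ℕ => (T : ℝ) ^ (-d)) atTop (𝓝 0) :=
  (tendsto_rpow_neg_atTop hd).comp tendsto_natCast_atTop_atTop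

end Rates

section Estimation

open Matrix

attribute [local instance] Matrix.normedAddCommGroup Matrix.normedSpace

variable {N r : ℕ}

theorem exists_betaHat_bound {Λ : Matrix (Fin N) (Fin r) ℝ} (hΛ : AndersonRubinCondition Λ)
    {s : Fin N → ℝ} (hs : ∀ i, 0 < s i) (K : ℝ) :
    ∃ C ε₀ : ℝ, 0 ≤ C ∧ 0 < ε₀ ∧ ∀ (S : Matrix (Fin N) (Fin N) ℝ) (L : Matrix (Fin N) (Fin r) ℝ)
      (ψ y β : Fin N → ℝ) (a α : Fin r → ℝ) (T : Finset (Fin N)),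
      ‖α‖ ≤ K → (∀ i ∈ T, β i = 0) → N / 2 + r ≤ T.card →
      (∀ S ⊆ T, T.card + N / 2 + 1 ≤ N + S.card →
        Submodule.span ℝ (Λ.row '' (S : Set (Fin N))) = ⊤) →
      ((∃ (L : Matrix (Fin N) (Fin r) ℝ) (ψ : Fin N → ℝ), IsFactorMLE S L ψ) →
        IsFactorMLE S L ψ) →
      IsLTS L y a → ‖S - (Λ * Λᵀ + diagonal s)‖ + ‖y - (β + Λ *ᵥ α)‖ ≤ ε₀ →
      ‖betaHat L y a - β‖ ≤ C * (‖S - (Λ * Λᵀ + diagonal s)‖ + ‖y - (β + Λ *ᵥ α)‖) := by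
  rcases Nat.eq_zero_or_pos r with rfl | hr
  · refine ⟨1, 1, zero_le_one, one_pos, fun S L ψ y β a α T _ _ _ _ _ _ _ => ?_⟩
    have hmulVec : ∀ (L : Matrix (Fin N) (Fin 0) ℝ) a, L *ᵥ a = 0 := fun L a => by
      ext i
      simp [mulVec, dotProduct]
    rw [betaHat, hmulVec, hmulVec, sub_zero, add_zero, one_mul]
    exact le_add_of_nonneg_left (norm_nonneg _)
  obtain ⟨C₁, ε₁, hC₁, hε₁, hmle⟩ := hΛ.exists_mle_bound hs
  obtain ⟨C₂, ε₂, hC₂, hε₂, hlts⟩ := exists_lts_bound Λ K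
  refine ⟨C₂ * (C₁ + 1), min ε₁ (ε₂ / (C₁ + 1)), by positivity, by positivity, ?_⟩
  intro S L ψ y β a α T hα hβ hT hgp hL ha he
  have hS0 := norm_nonneg (S - (Λ * Λᵀ + diagonal s))
  have hy0 := norm_nonneg (y - (β + Λ *ᵥ α))
  set e := ‖S - (Λ * Λᵀ + diagonal s)‖ + ‖y - (β + Λ *ᵥ α)‖
  obtain ⟨hex, hclose⟩ := hmle S (by linarith [he.trans (min_le_left _ _)])
  obtain ⟨Q, hQ, hLQ⟩ := hclose L ψ (hL hex)
  have he₂ : (C₁ + 1) * e ≤ ε₂ :=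
    (le_div_iff₀' (by positivity)).1 (he.trans (min_le_right _ _))
  rw [mul_assoc, ← betaHat_mul_right hQ]
  refine hlts _ y β _ α _ T he₂ hα hβ (by omega) hgp ?_ ?_ (ha.mul_right hQ)
  · nlinarith [mul_nonneg hC₁ hy0]
  · nlinarith [mul_nonneg hC₁ (hS0.trans (le_add_of_nonneg_right hy0))]

theorem selected_eq_of_norm_le {L : Matrix (Fin N) (Fin r) ℝ} {y β : Fin N → ℝ} {a : Fin r → ℝ}
    {T : Finset (Fin N)} (hT : ∀ i, i ∈ T ↔ β i = 0) {thr c : ℝ} (hc : ∀ i, β i ≠ 0 → c ≤ |β i|)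
    (hthr : ‖betaHat L y a - β‖ ≤ thr) (hthr' : thr + ‖betaHat L y a - β‖ < c) :
    selected L y a thr = T := by
  ext i
  have hres : y i - L.row i ⬝ᵥ a = betaHat L y a i := rfl
  have hi : |betaHat L y a i - β i| ≤ ‖betaHat L y a - β‖ := norm_le_pi_norm (betaHat L y a - β) i
  simp only [selected, Finset.mem_filter, Finset.mem_univ, true_and, hres, hT i]
  refine ⟨fun hle => ?_, fun hzero => ?_⟩
  · by_contra hne
    have hsub := abs_sub_abs_le_abs_sub (β i) (betaHat L y a i)
    rw [abs_sub_comm] at hsub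
    linarith [hc i hne]
  · rw [hzero, sub_zero] at hi
    exact hi.trans hthr

variable {Ω : Type*} [MeasurableSpace Ω] {μ : Measure Ω} {P : Panel Ω N r} {t : ℕ → ℕ}
  {y : ℕ → Ω → Fin N → ℝ} {L : ℕ → Ω → Matrix (Fin N) (Fin r) ℝ} {ψ : ℕ → Ω → Fin N → ℝ}
  {a : ℕ → Ω → Fin r → ℝ}

/-- The total error of the two inputs from which `Λ̂`, `α̂` and `σ̂` are computed, the sample
covariance matrix and the estimate `y` of the trend at time `t`, in the supremum norm. -/
noncomputable def Panel.inputError (P : Panel Ω N r) (μ : Measure Ω) (t : ℕ → ℕ)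
    (y : ℕ → Ω → Fin N → ℝ) (T : ℕ) (ω : Ω) : ℝ :=
  ‖P.preCov T ω - (P.Λ * P.Λᵀ + diagonal fun i => P.σ i ^ 2)‖ + ‖y T ω - P.trend μ T (t T)‖

theorem Panel.inputError_nonneg (T : ℕ) (ω : Ω) : 0 ≤ P.inputError μ t y T ω :=
  add_nonneg (norm_nonneg _) (norm_nonneg _)

theorem Panel.isBigOp_inputError [IsProbabilityMeasure μ] {ρ d : ℝ} (hρ : 0 < ρ)
    (hT0 : Tendsto (fun T : ℕ => (P.T0 T : ℝ) / (T : ℝ)) atTop (𝓝 ρ))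
    (hcons : P.Consistency) (hmodel : P.LinearFactorModel μ) (hcov : P.FactorCovariances μ)
    (hmix : P.BoundedMixing μ) (ht : ∀ᶠ T in atTop, P.T0 T < t T ∧ t T ≤ T) (hd : d ≤ 1 / 2)
    (hy : ∀ i, IsBigOp μ (fun T ω => y T ω i - P.trend μ T (t T) i) (fun T => (T : ℝ) ^ (-d))) :
    IsBigOp μ (P.inputError μ t y) (fun T => (T : ℝ) ^ (-d)) := by
  have hpos : ∀ᶠ T in atTop, 0 < P.T0 T ∧ P.T0 T ≤ T := by
    filter_upwards [ht, hT0.eventually_const_lt hρ] with T htT hT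
    refine ⟨Nat.pos_of_ne_zero fun hzero => ?_, htT.1.le.trans htT.2⟩
    simp [hzero] at hT
  exact ((isBigOp_norm_preCov_sub hcons hmodel hcov hmix hpos).trans_isBigO
    (isBigO_rpow_neg_of_tendsto_div hρ hT0 (by norm_num) hd)
    (.of_forall fun T => by positivity)).add (.norm_pi fun i => (hy i).abs)

theorem Panel.exists_eventually_norm_betaHat_sub_le (hσ : ∀ i, 0 < P.σ i)
    (hmaj : P.MajorityControls) (hAR : P.AndersonRubin) (hgp : P.GeneralPosition)
    (ht : ∀ᶠ T in atTop, P.T0 T < t T ∧ t T ≤ T)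
    (hα : ∃ K : ℝ, ∀ᶠ T in atTop, ∀ k, |P.factorMean μ T (t T) k| ≤ K)
    (hL : ∀ T ω, (∃ L ψ, IsFactorMLE (r := r) (P.preCov T ω) L ψ) →
      IsFactorMLE (P.preCov T ω) (L T ω) (ψ T ω))
    (ha : ∀ᶠ T in atTop, ∀ ω, IsLTS (L T ω) (y T ω) (a T ω)) :
    ∃ C ε₀ : ℝ, 0 ≤ C ∧ 0 < ε₀ ∧ ∀ᶠ T in atTop, ∀ ω, P.inputError μ t y T ω ≤ ε₀ →
      ‖betaHat (L T ω) (y T ω) (a T ω) - P.β T (t T)‖ ≤ C * P.inputError μ t y T ω := by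
  obtain ⟨K, hK⟩ := hα
  obtain ⟨C, ε₀, hC, hε₀, hbound⟩ :=
    exists_betaHat_bound (Λ := P.Λ) hAR (fun i => pow_pos (hσ i) 2) |K|
  refine ⟨C, ε₀, hC, hε₀, ?_⟩
  filter_upwards [ht, hK, ha] with T htT hKT haT ω hω
  exact hbound _ _ (ψ T ω) _ _ _ (P.factorMean μ T (t T)) (P.controls T (t T))
    ((pi_norm_le_iff_of_nonneg (abs_nonneg K)).2 fun k => (hKT k).trans (le_abs_self K))
    (fun i hi => by simpa [Panel.controls] using hi) (hmaj T (t T) htT.1 htT.2)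
    (hgp T (t T) htT.1 htT.2) (hL T ω) (haT ω) hω

theorem Panel.eventually_selected_eq_controls (hσ : ∀ i, 0 < P.σ i)
    (hβ : ∃ c : ℝ, 0 < c ∧ ∀ᶠ T in atTop, ∀ i, P.β T (t T) i ≠ 0 → c ≤ |P.β T (t T) i|)
    {d C ε₀ : ℝ} (hd : 0 < d) (hC : 0 ≤ C) (hε₀ : 0 < ε₀)
    (hbound : ∀ᶠ T in atTop, ∀ ω, P.inputError μ t y T ω ≤ ε₀ →
      ‖betaHat (L T ω) (y T ω) (a T ω) - P.β T (t T)‖ ≤ C * P.inputError μ t y T ω) (M : ℝ) :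
    ∀ᶠ T : ℕ in atTop, ∀ ω, P.inputError μ t y T ω ≤ M * (T : ℝ) ^ (-d) →
      selected (L T ω) (y T ω) (a T ω)
        (√(2 * Real.log ((N : ℝ) * (T : ℝ))) * P.sigmaHat T ω / (T : ℝ) ^ d) =
          P.controls T (t T) := by
  rcases Nat.eq_zero_or_pos N with rfl | hN
  · exact .of_forall fun T ω _ => Subsingleton.elim _ _
  obtain ⟨c, hc0, hc⟩ := hβ
  obtain ⟨m, b, ε₁, hm, hε₁, hσhat⟩ :=
    exists_sigmaHat_bounds (Ω := Ω) hN P.Λ fun i => pow_pos (hσ i) 2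
  have herr : Tendsto (fun T : ℕ => M * (T : ℝ) ^ (-d)) atTop (𝓝 0) := by
    simpa using (tendsto_natCast_rpow_neg hd).const_mul M
  have hthr : Tendsto (fun T : ℕ => √(2 * Real.log ((N : ℝ) * T)) / (T : ℝ) ^ d * b +
      C * (M * (T : ℝ) ^ (-d))) atTop (𝓝 0) := by
    simpa using ((tendsto_sqrt_log_div_rpow hd).mul_const b).add (herr.const_mul C)
  filter_upwards [hbound, hc, herr.eventually_le_const hε₀, herr.eventually_le_const hε₁,
    hthr.eventually_lt_const hc0,
    (tendsto_sqrt_log_atTop hN).eventually_ge_atTop (C * M / m)] with T hT hcT h₀ h₁ hthrT hlog ω hω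
  obtain ⟨hlow, hup⟩ := hσhat P T ω
    ((le_add_of_nonneg_right (norm_nonneg _)).trans (hω.trans h₁))
  have hβhat := (hT ω (hω.trans h₀)).trans (mul_le_mul_of_nonneg_left hω hC)
  rw [mul_div_right_comm]
  refine selected_eq_of_norm_le (fun i => by simp [Panel.controls]) hcT (hβhat.trans ?_) ?_
  · calc C * (M * (T : ℝ) ^ (-d)) = C * M * (T : ℝ) ^ (-d) := (mul_assoc _ _ _).symm
      _ ≤ √(2 * Real.log ((N : ℝ) * T)) * m * (T : ℝ) ^ (-d) :=
          mul_le_mul_of_nonneg_right ((div_le_iff₀ hm).1 hlog) (by positivity)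
      _ ≤ √(2 * Real.log ((N : ℝ) * T)) * P.sigmaHat T ω * (T : ℝ) ^ (-d) := by gcongr
      _ = √(2 * Real.log ((N : ℝ) * T)) / (T : ℝ) ^ d * P.sigmaHat T ω := by
          rw [Real.rpow_neg T.cast_nonneg]
          ring
  · refine lt_of_le_of_lt (add_le_add ?_ hβhat) hthrT
    exact mul_le_mul_of_nonneg_left hup (by positivity)

end Estimation

end SCI

theorem theorem2_general {Ω : Type*} [MeasurableSpace Ω] (μ : Measure Ω) [IsProbabilityMeasure μ]
    {N r : ℕ} (P : SCI.Panel Ω N r) (ρ : ℝ) (hρ : 0 < ρ)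
    (hT0 : Tendsto (fun T : ℕ => (P.T0 T : ℝ) / (T : ℝ)) atTop (𝓝 ρ))
    (hcons : P.Consistency) (hmodel : P.LinearFactorModel μ) (hcov : P.FactorCovariances μ)
    (hmaj : P.MajorityControls) (hmix : P.BoundedMixing μ)
    (hAR : P.AndersonRubin) (hgp : P.GeneralPosition)
    (t : ℕ → ℕ) (ht : ∀ᶠ T in atTop, P.T0 T < t T ∧ t T ≤ T)
    (hα : ∃ K : ℝ, ∀ᶠ T in atTop, ∀ k, |P.factorMean μ T (t T) k| ≤ K)
    (hβ : ∃ c : ℝ, 0 < c ∧ ∀ᶠ T in atTop, ∀ i, P.β T (t T) i ≠ 0 → c ≤ |P.β T (t T) i|)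
    (d : ℝ) (hd0 : 0 < d) (hd1 : d ≤ 1 / 2) (τhat : ℕ → Ω → Fin N → ℝ)
    (hτ : ∀ i, SCI.IsBigOp μ (fun T ω => τhat T ω i - P.trend μ T (t T) i)
      (fun T => (T : ℝ) ^ (-d)))
    (Λhat : ℕ → Ω → Matrix (Fin N) (Fin r) ℝ) (ψhat : ℕ → Ω → Fin N → ℝ)
    (hΛ : ∀ T ω, (∃ L ψ, SCI.IsFactorMLE (r := r) (P.preCov T ω) L ψ) →
      SCI.IsFactorMLE (P.preCov T ω) (Λhat T ω) (ψhat T ω))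
    (αhat : ℕ → Ω → Fin r → ℝ)
    (hLTS : ∀ᶠ T in atTop, ∀ ω, SCI.IsLTS (Λhat T ω) (τhat T ω) (αhat T ω)) :
    (∀ i, SCI.IsBigOp μ
      (fun T ω => SCI.betaHat (Λhat T ω) (τhat T ω) (αhat T ω) i - P.β T (t T) i)
      (fun T => (T : ℝ) ^ (-d))) ∧
    Tendsto (fun T : ℕ => μ.real {ω | SCI.selected (Λhat T ω) (τhat T ω) (αhat T ω)
      (√(2 * Real.log ((N : ℝ) * (T : ℝ))) * P.sigmaHat T ω / (T : ℝ) ^ d) =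
        P.controls T (t T)}) atTop (𝓝 1) := by
  have herror : SCI.IsBigOp μ (P.inputError μ t τhat) fun T => (T : ℝ) ^ (-d) :=
    P.isBigOp_inputError hρ hT0 hcons hmodel hcov hmix ht hd1 hτ
  obtain ⟨C, ε₀, hC, hε₀, hbound⟩ :=
    P.exists_eventually_norm_betaHat_sub_le hcov.2.1 hmaj hAR hgp ht hα hΛ hLTS
  refine ⟨fun i => ?_, ?_⟩
  · refine herror.of_eventually_abs_le_mul (SCI.tendsto_natCast_rpow_neg hd0) hC hε₀ ?_
    filter_upwards [hbound] with T hT ω hω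
    rw [abs_of_nonneg (P.inputError_nonneg T ω)] at hω ⊢
    exact (norm_le_pi_norm (SCI.betaHat _ _ _ - P.β T (t T)) i).trans (hT ω hω)
  · refine herror.tendsto_measureReal_one fun M => ?_
    filter_upwards [P.eventually_selected_eq_controls hcov.2.1 hβ hd0 hC hε₀ hbound M]
      with T hT ω hω
    exact hT ω ((le_abs_self _).trans hω)

theorem theorem2 {Ω : Type*} [MeasurableSpace Ω] (μ : Measure Ω) [IsProbabilityMeasure μ]
    {N r : ℕ} (P : SCI.Panel Ω N r)
    -- the numbers of pre- and post-intervention periods are comparable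
    (ρ : ℝ) (hρ0 : 0 < ρ) (hρ1 : ρ < 1)
    (hT0 : Tendsto (fun T : ℕ => (P.T0 T : ℝ) / (T : ℝ)) atTop (𝓝 ρ))
    -- the model
    (hcons : P.Consistency) (hmodel : P.LinearFactorModel μ) (hmom : P.FactorMoments μ)
    (hmaj : P.MajorityControls) (hmix : P.StationaryMixing μ)
    (hAR : P.AndersonRubin) (hgp : P.GeneralPosition)
    -- the post-intervention time `t`, which moves with the horizon; the factor mean at `t` stays
    -- bounded and the nonzero effects at `t` stay away from zero
    (t : ℕ → ℕ) (ht : ∀ᶠ T in atTop, P.T0 T < t T ∧ t T ≤ T)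
    (hα : ∃ K : ℝ, ∀ᶠ T in atTop, ∀ k, |P.factorMean μ T (t T) k| ≤ K)
    (hβ : ∃ c : ℝ, 0 < c ∧ ∀ᶠ T in atTop, ∀ i, P.β T (t T) i ≠ 0 → c ≤ |P.β T (t T) i|)
    -- the trend estimator
    (d : ℝ) (hd0 : 0 < d) (hd1 : d ≤ 1 / 2)
    (τhat : ℕ → ℕ → Ω → Fin N → ℝ) (hτm : ∀ T s, Measurable (τhat T s))
    (hτ : ∀ i, SCI.IsBigOp μ (fun T ω => τhat T (t T) ω i - P.trend μ T (t T) i)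
      (fun T => (T : ℝ) ^ (-d)))
    -- factor analysis of the pre-intervention data
    (Λhat : ℕ → Ω → Matrix (Fin N) (Fin r) ℝ) (ψhat : ℕ → Ω → Fin N → ℝ)
    (hΛm : ∀ T i k, Measurable fun ω => Λhat T ω i k)
    (hΛ : ∀ T ω, (∃ L ψ, SCI.IsFactorMLE (r := r) (P.preCov T ω) L ψ) →
      SCI.IsFactorMLE (P.preCov T ω) (Λhat T ω) (ψhat T ω))
    -- least trimmed squares at each post-intervention time
    (αhat : ℕ → ℕ → Ω → Fin r → ℝ) (hαm : ∀ T s, Measurable (αhat T s))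
    (hLTS : ∀ T s, P.T0 T < s → s ≤ T → ∀ ω,
      SCI.IsLTS (Λhat T ω) (τhat T s ω) (αhat T s ω)) :
    (∀ i, SCI.IsBigOp μ
      (fun T ω => SCI.betaHat (Λhat T ω) (τhat T (t T) ω) (αhat T (t T) ω) i - P.β T (t T) i)
      (fun T => (T : ℝ) ^ (-d))) ∧
    Tendsto (fun T : ℕ => μ.real {ω |
      SCI.selected (Λhat T ω) (τhat T (t T) ω) (αhat T (t T) ω)
        (√(2 * Real.log ((N : ℝ) * (T : ℝ))) * P.sigmaHat T ω / (T : ℝ) ^ d) =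
          P.controls T (t T)}) atTop (𝓝 1) :=
  theorem2_general μ P ρ hρ0 hT0 hcons hmodel hmom.factorCovariances hmaj hmix.boundedMixing hAR hgp
    t ht hα hβ d hd0 hd1 (fun T => τhat T (t T)) hτ Λhat ψhat hΛ (fun T => αhat T (t T))
    (ht.mono fun T hT => hLTS T (t T) hT.1 hT.2)
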